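/- **Setting.** A network has a finite node set $\mathcal N$ and directed links $\mathcal L\subset\mathcal N\times\mathcal N$; write $\mathrm{out}(n)$, $\mathrm{in}(n)$ for the links leaving and entering $n$, and $d_{\max}$ for the largest in-degree. Commodity $c\in\mathcal N$ is the data destined for node $c$. Time is slotted. The channel state $S(t)$ and the energy state $j(t)$ evolve independently as irreducible aperiodic Markov chains on finite sets $\mathcal S,\mathcal J$, with steady-state distributions $\pi_s$, $\pi_j$; in energy state $j$ node $n$ can harvest up to $h_n^{j}\ge 0$. In channel state $s$ the power vector $P=(P_l)_{l\in\mathcal L}$ is chosen from a nonempty compact set $\mathcal P^{(s)}\subset[0,\infty)^{\mathcal L}$ that is closed under setting entries to zero, with $\sum_{l\in \mathrm{out}(n)}P_l\le P_{\max}$ for all $n$. The link rates satisfy $0\le\mu_l(s,P)\le\mu_{\max}$ and, if $P'$ arises from $P\in\mathcal P^{(s)}$ by setting $P_l$ to zero, $\mu_l(s,P)\le\mu_l(s,P')+\delta P_l$ (with a constant $\delta>0$) and $\mu_k(s,P)\le\mu_k(s,P')$ for $k\ne l$. The utilities $U_n^{(c)}:[0,\infty)\to\mathbb R$ are nondecreasing,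 concave and continuously differentiable with $U^{(c)}_n(0)=0$; $\beta=\max_{n,c}(U^{(c)}_n)'(0)$. Admitted amounts lie in $[0,R_{\max}]$, and $\gamma=R_{\max}+d_{\max}\mu_{\max}$. **Dual problem.** For $V\ge1$ and $y=(\upsilon,\nu)$ with $\upsilon=(\upsilon_n^{(c)})\ge0$, $\upsilon_c^{(c)}=0$, and $\nu\in\mathbb R^{\mathcal N}$, let $$g_V(y)=\sup\sum_{s}\pi_{s}\sum_{j}\pi_{j}\Big\{V\sum_{n,c}U^{(c)}_n(r^{nc})-\sum_{n,c}\upsilon_n^{(c)}\Big[r^{nc}+\sum_{l\in\mathrm{in}(n)}\mu_{l}^{(c),s}-\sum_{l\in\mathrm{out}(n)}\mu_l^{(c),s}\Big]-\sum_n\nu_n\Big[\sum_{l\in\mathrm{out}(n)}P_l^{s}-e_n^{j}\Big]\Big\},$$ the supremum being over $r^{nc}\in[0,R_{\max}]$, $P^s\in\mathcal P^{(s)}$, $\mu_l^{(c),s}\ge0$ with $\sum_c\mu_l^{(c),s}\le\mu_l(s,P^s)$, and $e^j_n\in[0,h^j_n]$. The dual problem is to minimize $g_V$ over these $y$. **ESA**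 with parameters $V$ and $\theta\in\mathbb R^{\mathcal N}$ starts with $Q(0)=0$, $E(0)=0$. In each slot $t$, without anticipating future states: (i) $e_n(t)$ is the whole harvestable energy if $E_n(t)<\theta_n$, and $0$ otherwise; (ii) $R^{(c)}_n(t)$ maximizes $VU^{(c)}_n(r)-Q^{(c)}_n(t)r$ over $r\in[0,R_{\max}]$; (iii) with $W^{(c)}_{[n,b]}=\max\{Q^{(c)}_n-Q^{(c)}_b-\gamma,0\}$ and $W_l=\max_cW_l^{(c)}$, $P(t)$ maximizes $\sum_n\big[\sum_{l\in\mathrm{out}(n)}\mu_l(S(t),P)W_l(t)+(E_n(t)-\theta_n)\sum_{l\in\mathrm{out}(n)}P_l\big]$ over those $P\in\mathcal P^{(S(t))}$ with $\sum_{l\in\mathrm{out}(n)}P_l\le E_n(t)$ for all $n$; (iv) each link $l$ with $W_l(t)>0$ gives its full rate to one commodity of maximal weight, so $\mu_l^{(c)}(t)=\mu_l(S(t),P(t))$ for this commodity, and all other $\mu_l^{(c)}(t)$ are $0$. Then (with idle-fill) $Q_n^{(c)}(t+1)=\max\{Q_n^{(c)}(t)-\sum_{l\in\mathrm{out}(n)}\mu_l^{(c)}(t),0\}+\sum_{l\in\mathrm{in}(n)}\mu_l^{(c)}(t)+R_n^{(c)}(t)$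 for $n\neq c$, $Q_c^{(c)}\equiv0$, and $E_n(t+1)=E_n(t)-\sum_{l\in\mathrm{out}(n)}P_l(t)+e_n(t)$. **Theorem.** Suppose that for every $V\ge1$ the dual problem has a (finite) unique optimal solution $y^*=y^*_V=(\upsilon^*,\nu^*)$, and that for some constant $L>0$ independent of $V$ $$g_V(y)\ \ge\ g_V(y^*)+L\,\|y^*-y\|\qquad\text{for all }V\ge 1\text{ and all dual feasible }y,$$ with the Euclidean norm. Then $y^*$ is linear in $V$: there is a vector $y_1$ independent of $V$ with $y^*_V=Vy_1$ for all $V\ge1$; in particular $\|y^*_V\|=\Theta(V)$ unless $y_1=0$. Moreover there are constants $D,K,c^*>0$ independent of $V$ such that for every $V\ge1$, every $\theta$ with $\theta_n\ge\delta\beta V+P_{\max}$ and $\theta_n-\nu_n^*>0$ for all $n$, every run of ESA with parameters $V,\theta$, and every $m\ge0$, $$\limsup_{t\to\infty}\frac1t\sum_{\tau=0}^{t-1}\Pr\Big\{\exists (n,c):|Q^{(c)}_n(\tau)-\upsilon^{(c)*}_n|>D+Km\ \text{ or }\ \exists n:|(E_n(\tau)-\theta_n)+\nu^*_n|>D+Km\Big\}\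 \le\ c^*e^{-m}.$$ That is, the queues are exponentially attracted to the point $(\upsilon^*,\theta-\nu^*)$. -/

import Mathlib

open MeasureTheory ProbabilityTheory Filter Asymptotics

noncomputable section

/-! ## Finite Markov chains -/

/-- `A` is the transition matrix of an irreducible and aperiodic Markov chain on the finite
set `X`: rows are probability vectors, the graph of positive entries is strongly connected, and
at every state the return times with positive probability have greatest common divisor `1`. -/
structure IsErgodicChain {X : Type*} [Fintype X] [DecidableEq X] (A : Matrix X X ℝ) : Prop where
  stochastic : A ∈ Matrix.rowStochastic ℝ X
  irreducible : A.IsIrreducible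
  aperiodic : ∀ (i : X) (d : ℕ), (∀ k : ℕ, 0 < k → 0 < (A ^ k) i i → d ∣ k) → d = 1

/-- `p` is a stationary (steady state) distribution of the transition matrix `A`. -/
def IsStationaryDist {X : Type*} [Fintype X] (A : Matrix X X ℝ) (p : X → ℝ) : Prop :=
  p ∈ stdSimplex ℝ X ∧ Matrix.vecMul p A = p

/-! ## The network model -/

/-- An energy harvesting network with node set `N` (every node `c` is also a commodity, the data
destined for `c`), channel states `S` and energy states `J`.  Power vectors and rates are indexed
by the directed links. -/
structure EnergyNetwork (N S J : Type*) [Fintype N] [DecidableEq N] where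
  /-- the directed links `[n, m]` -/
  links : Finset (N × N)
  /-- the maximal amount of data of one commodity admitted at a node per slot -/
  Rmax : ℝ
  Rmax_nonneg : 0 ≤ Rmax
  /-- `U n c` is the utility, as a function on `[0, ∞)`, of commodity `c` data admitted at `n` -/
  U : N → N → ℝ → ℝ
  U_zero : ∀ n c, U n c 0 = 0
  U_mono : ∀ n c, MonotoneOn (U n c) (Set.Ici 0)
  U_concave : ∀ n c, ConcaveOn ℝ (Set.Ici 0) (U n c)
  U_contDiff : ∀ n c, ContDiffOn ℝ 1 (U n c) (Set.Ici 0)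
  /-- the maximal total power spent by a node per slot -/
  Pmax : ℝ
  /-- the feasible power vectors in each channel state -/
  power : S → Set (links → ℝ)
  power_nonempty : ∀ s, (power s).Nonempty
  power_compact : ∀ s, IsCompact (power s)
  power_nonneg : ∀ s, ∀ P ∈ power s, ∀ l, 0 ≤ P l
  power_le : ∀ s, ∀ P ∈ power s, ∀ n, ∑ l : links with l.1.1 = n, P l ≤ Pmax
  /-- switching off a link preserves feasibility -/
  power_update : ∀ s, ∀ P ∈ power s, ∀ l, Function.update P l 0 ∈ power s
  /-- the rate-power function: `rate s P l` is the rate of link `l` -/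
  rate : S → (links → ℝ) → links → ℝ
  /-- a uniform bound on all rates -/
  μmax : ℝ
  rate_nonneg : ∀ s, ∀ P ∈ power s, ∀ l, 0 ≤ rate s P l
  rate_le : ∀ s, ∀ P ∈ power s, ∀ l, rate s P l ≤ μmax
  /-- the slope bound of the rate in the own power -/
  δ : ℝ
  δ_pos : 0 < δ
  rate_own : ∀ s, ∀ P ∈ power s, ∀ l, rate s P l ≤ rate s (Function.update P l 0) l + δ * P l
  rate_other : ∀ s, ∀ P ∈ power s, ∀ l k, k ≠ l → rate s P k ≤ rate s (Function.update P l 0) k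
  /-- the harvestable energy of each node in each energy state -/
  harvest : J → N → ℝ
  harvest_nonneg : ∀ j n, 0 ≤ harvest j n

namespace EnergyNetwork

variable {N S J : Type*} [Fintype N] [DecidableEq N]

/-- Sum over the outgoing links of node `n`. -/
def outSum (G : EnergyNetwork N S J) (f : G.links → ℝ) (n : N) : ℝ :=
  ∑ l : G.links with l.1.1 = n, f l

/-- Sum over the incoming links of node `n`. -/
def inSum (G : EnergyNetwork N S J) (f : G.links → ℝ) (n : N) : ℝ :=
  ∑ l : G.links with l.1.2 = n, f l

/-- The maximal in-degree. -/
def dmax (G : EnergyNetwork N S J) : ℕ :=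
  Finset.univ.sup fun n : N => (G.links.filter fun l => l.2 = n).card

/-- The constant `γ = R_max + d_max μ_max` used in the link weights. -/
def γ (G : EnergyNetwork N S J) : ℝ := G.Rmax + G.dmax * G.μmax

/-- The maximum `β` over `(n, c)` of the (one-sided) derivatives of the utilities at `0`. -/
def β (G : EnergyNetwork N S J) : ℝ :=
  ⨆ p : N × N, derivWithin (G.U p.1 p.2) (Set.Ici 0) 0

/-! ## The dual problem -/

/-- A choice of all variables of the dual function: admitted rates `r`, and, for every channel
state, a power vector and a split of the link rates among the commodities, and, for every energy
state, harvested amounts. -/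
structure Decision (G : EnergyNetwork N S J) where
  r : N → N → ℝ
  P : S → G.links → ℝ
  split : S → G.links → N → ℝ
  e : J → N → ℝ

/-- The constraints on the variables of the dual function. -/
structure Decision.Feasible {G : EnergyNetwork N S J} (x : G.Decision) : Prop where
  r_mem : ∀ n c, x.r n c ∈ Set.Icc 0 G.Rmax
  P_mem : ∀ s, x.P s ∈ G.power s
  split_nonneg : ∀ s l c, 0 ≤ x.split s l c
  split_le : ∀ s l, ∑ c, x.split s l c ≤ G.rate s (x.P s) l
  e_mem : ∀ j n, x.e j n ∈ Set.Icc 0 (G.harvest j n)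

/-- The expression maximized in the dual function at the dual vector `y = (υ, ν)`. -/
def lagrangian [Fintype S] [Fintype J] (G : EnergyNetwork N S J) (πS : S → ℝ) (πJ : J → ℝ)
    (V : ℝ) (y : (N → N → ℝ) × (N → ℝ)) (x : G.Decision) : ℝ :=
  ∑ s, πS s * ∑ j, πJ j *
    ((V * ∑ n, ∑ c, G.U n c (x.r n c))
      - (∑ n, ∑ c, y.1 n c *
          (x.r n c + G.inSum (fun l => x.split s l c) n - G.outSum (fun l => x.split s l c) n))
      - (∑ n, y.2 n * (G.outSum (x.P s) n - x.e j n)))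

/-- The dual function `g`, for the parameter `V` and the state distributions `πS`, `πJ`. -/
def dual [Fintype S] [Fintype J] (G : EnergyNetwork N S J) (πS : S → ℝ) (πJ : J → ℝ)
    (V : ℝ) (y : (N → N → ℝ) × (N → ℝ)) : ℝ :=
  sSup (G.lagrangian πS πJ V y '' {x | x.Feasible})

end EnergyNetwork

/-- The feasible dual vectors `y = (υ, ν)`: `υ ≥ 0` and `ν` is free.  Data that have reached their
destination have left the network, so there is no constraint, hence no multiplier, for the pairs
`(c, c)`. -/
def DualFeasible {N : Type*} (y : (N → N → ℝ) × (N → ℝ)) : Prop :=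
  (∀ n c, 0 ≤ y.1 n c) ∧ ∀ c, y.1 c c = 0

/-- The Euclidean length of a dual vector. -/
def dualNorm {N : Type*} [Fintype N] (y : (N → N → ℝ) × (N → ℝ)) : ℝ :=
  √((∑ n, ∑ c, y.1 n c ^ 2) + ∑ n, y.2 n ^ 2)

namespace EnergyNetwork

variable {N S J : Type*} [Fintype N] [DecidableEq N]

/-- `y` is an optimal solution of the dual problem. -/
def IsDualOptimum [Fintype S] [Fintype J] (G : EnergyNetwork N S J) (πS : S → ℝ) (πJ : J → ℝ)
    (V : ℝ) (y : (N → N → ℝ) × (N → ℝ)) : Prop :=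
  DualFeasible y ∧ ∀ z, DualFeasible z → G.dual πS πJ V y ≤ G.dual πS πJ V z

/-! ## The energy-limited scheduling algorithm (ESA) -/

/-- The weight of commodity `c` over link `l` when the data queues are `Q`. -/
def weight (G : EnergyNetwork N S J) (Q : N → N → ℝ) (l : G.links) (c : N) : ℝ :=
  max (Q l.1.1 c - Q l.1.2 c - G.γ) 0

/-- The link weight, the maximum of the weights of the commodities. -/
def linkWeight (G : EnergyNetwork N S J) (Q : N → N → ℝ) (l : G.links) : ℝ :=
  ⨆ c, G.weight Q l c

/-- The objective of the power allocation. -/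
def powerObjective (G : EnergyNetwork N S J) (θ : N → ℝ) (s : S) (Q : N → N → ℝ) (E : N → ℝ)
    (P : G.links → ℝ) : ℝ :=
  ∑ n, (G.outSum (fun l => G.rate s P l * G.linkWeight Q l) n + (E n - θ n) * G.outSum P n)

/-- The power vectors that are feasible and respect the energy availability constraint. -/
def availablePower (G : EnergyNetwork N S J) (s : S) (E : N → ℝ) : Set (G.links → ℝ) :=
  {P | P ∈ G.power s ∧ ∀ n, G.outSum P n ≤ E n}

/-- A run of ESA with parameters `V` and `θ` on a probability space `(Ω, μ)`, where the channel
state and the energy state are independently evolving Markov chains with transition matrices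
`A` and `B`.  Ties between optimal actions may be broken in any non-anticipating way: the filtration
`ℱ` is the information available in each slot, including any randomness used for the actions. -/
structure ESARun (G : EnergyNetwork N S J) (A : Matrix S S ℝ) (B : Matrix J J ℝ) (V : ℝ)
    (θ : N → ℝ) {Ω : Type*} [mΩ : MeasurableSpace Ω] (μ : Measure Ω) where
  ℱ : Filtration ℕ mΩ
  /-- channel states -/
  chan : ℕ → Ω → S
  /-- energy states -/
  energy : ℕ → Ω → J
  /-- data queues -/
  Q : ℕ → Ω → N → N → ℝ
  /-- energy queues -/
  E : ℕ → Ω → N → ℝ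
  /-- admitted data -/
  R : ℕ → Ω → N → N → ℝ
  /-- allocated powers -/
  P : ℕ → Ω → G.links → ℝ
  /-- rates allocated to the commodities over the links -/
  alloc : ℕ → Ω → G.links → N → ℝ
  /-- harvested energy -/
  e : ℕ → Ω → N → ℝ
  chan_adapted : ∀ t s, MeasurableSet[ℱ t] {ω | chan t ω = s}
  energy_adapted : ∀ t j, MeasurableSet[ℱ t] {ω | energy t ω = j}
  R_adapted : ∀ t n c, Measurable[ℱ t] fun ω => R t ω n c
  P_adapted : ∀ t l, Measurable[ℱ t] fun ω => P t ω l
  alloc_adapted : ∀ t l c, Measurable[ℱ t] fun ω => alloc t ω l c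
  markov : ∀ t s j, μ⟦{ω | chan (t + 1) ω = s ∧ energy (t + 1) ω = j} | ℱ t⟧
    =ᵐ[μ] fun ω => A (chan t ω) s * B (energy t ω) j
  Q_init : ∀ ω n c, Q 0 ω n c = 0
  E_init : ∀ ω n, E 0 ω n = 0
  /-- energy harvesting -/
  e_eq : ∀ t ω n, e t ω n = if E t ω n - θ n < 0 then G.harvest (energy t ω) n else 0
  /-- data admission -/
  R_mem : ∀ t ω n c, R t ω n c ∈ Set.Icc 0 G.Rmax
  R_max : ∀ t ω n c,
    IsMaxOn (fun r => V * G.U n c r - Q t ω n c * r) (Set.Icc 0 G.Rmax) (R t ω n c)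
  /-- power allocation -/
  P_mem : ∀ t ω, P t ω ∈ G.availablePower (chan t ω) (E t ω)
  P_max : ∀ t ω, IsMaxOn (G.powerObjective θ (chan t ω) (Q t ω) (E t ω))
    (G.availablePower (chan t ω) (E t ω)) (P t ω)
  /-- routing and scheduling: the full rate of a link with positive weight is given to one
  commodity of maximal weight, and links of zero weight are not used -/
  alloc_eq : ∀ t ω l, ∃ c, G.weight (Q t ω) l c = G.linkWeight (Q t ω) l ∧
    ∀ k, alloc t ω l k =
      if k = c ∧ 0 < G.linkWeight (Q t ω) l then G.rate (chan t ω) (P t ω) l else 0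
  /-- the queue updates; with idle-fill the allocated rates are always fully used -/
  Q_dest : ∀ t ω c, Q t ω c c = 0
  Q_step : ∀ t ω n c, n ≠ c → Q (t + 1) ω n c =
    max (Q t ω n c - G.outSum (fun l => alloc t ω l c) n) 0
      + G.inSum (fun l => alloc t ω l c) n + R t ω n c
  E_step : ∀ t ω n, E (t + 1) ω n = E t ω n - G.outSum (P t ω) n + e t ω n

/-- The event that, in slot `t`, some data queue is further than `a` from the respective entry of
`υ`, or some energy queue is further than `a` from the respective entry of `θ - ν`. -/
def ESARun.deviation {G : EnergyNetwork N S J} {A : Matrix S S ℝ} {B : Matrix J J ℝ} {V : ℝ}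
    {θ : N → ℝ} {Ω : Type*} [MeasurableSpace Ω] {μ : Measure Ω} (X : G.ESARun A B V θ μ)
    (y : (N → N → ℝ) × (N → ℝ)) (a : ℝ) (t : ℕ) : Set Ω :=
  {ω | ∃ n c, a < |X.Q t ω n c - y.1 n c|} ∪ {ω | ∃ n, a < |(X.E t ω n - θ n) + y.2 n|}

end EnergyNetwork

end

/-! Linearity in `V` is homogeneity. Replacing `(1, y)` by `(V, V • y)` multiplies the Lagrangian by
`V` without changing the decisions allowed, so `V • y` is optimal for `V` when `y` is optimal for
`1`, and uniqueness identifies it with `yStar V` (`dual_smul`, `IsDualOptimum.smul`).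

For the attraction, read the queues as the dual vector `dualPoint = (Q, θ - E)`. In each slot ESA
maximizes, up to an additive constant, the Lagrangian of the current state `i = (s, j)` at this
point, so the queue increments are approximate negative subgradients of `slotDual V i`
(`dualDot_drift_le`). Two features of ESA make this work. The offset `γ` in the weights keeps every
data queue below `β V + γ`, hence every weight below `β V` (`queue_le`, `linkWeight_le`). Then `θ ≥
δ β V + Pmax` makes it unprofitable to spend power at a node short of energy, so the energy
availability constraint costs nothing (`exists_availablePower`).

Consequently the squared distance of `dualPoint` to the optimum drifts by at most `2 F + C`, where
`F` is the value of `slotDual V i` at the optimum minus its value at `dualPoint`. The stationary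
mean of `F` is a difference of values of the dual function, at most `-L` times the distance by the
polyhedral hypothesis (`quadraticDrift`).

The state is a Markov chain, so this negative drift appears only after averaging over a block of `T`
slots, long enough for the transition probabilities to be close to stationary on average. Over a
block `F` changes by a bounded amount, and an exponential function of the distance contracts up to a
constant (`integral_exp_add_le`). Averaging over time and Markov's inequality finish the proof
(`exists_exponential_attraction`). All constants are independent of `V` and `θ`, because `V` enters
the affine functions defining `slotDual` only through their constant terms, not their slopes. -/

noncomputable section

/-! ## Convergence of finite Markov chains -/

namespace Matrix

variable {X : Type*} [Fintype X] [DecidableEq X] {A : Matrix X X ℝ}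

lemma pow_add_apply_pos (hA : A ∈ rowStochastic ℝ X) {i j k : X} {a b : ℕ}
    (h₁ : 0 < (A ^ a) i j) (h₂ : 0 < (A ^ b) j k) : 0 < (A ^ (a + b)) i k := by
  rw [pow_add, Matrix.mul_apply]
  exact Finset.sum_pos' (fun x _ => mul_nonneg (nonneg_of_mem_rowStochastic (pow_mem hA a))
    (nonneg_of_mem_rowStochastic (pow_mem hA b))) ⟨j, Finset.mem_univ _, mul_pos h₁ h₂⟩

lemma sum_abs_vecMul_le (hA : A ∈ rowStochastic ℝ X) (v : X → ℝ) :
    ∑ j, |(v ᵥ* A) j| ≤ ∑ i, |v i| := by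
  calc ∑ j, |(v ᵥ* A) j| ≤ ∑ j, ∑ i, |v i| * A i j := by
        refine Finset.sum_le_sum fun j _ => ?_
        refine (Finset.abs_sum_le_sum_abs _ _).trans_eq (Finset.sum_congr rfl fun i _ => ?_)
        rw [abs_mul, abs_of_nonneg (nonneg_of_mem_rowStochastic hA)]
    _ = ∑ i, |v i| := by
        rw [Finset.sum_comm]
        refine Finset.sum_congr rfl fun i _ => ?_
        rw [← Finset.mul_sum, sum_row_of_mem_rowStochastic hA, mul_one]

/-- Doeblin's contraction: as `v` sums to zero, lowering all entries of `A` by `ε` does not change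
`v ᵥ* A`, and the lowered matrix is nonnegative with row sums `1 - card X * ε`. -/
lemma sum_abs_vecMul_le_of_le (hA : A ∈ rowStochastic ℝ X) {ε : ℝ} (hε : ∀ i j, ε ≤ A i j)
    {v : X → ℝ} (hv : ∑ i, v i = 0) :
    ∑ j, |(v ᵥ* A) j| ≤ (1 - Fintype.card X * ε) * ∑ i, |v i| := by
  calc ∑ j, |(v ᵥ* A) j| ≤ ∑ j, ∑ i, |v i| * (A i j - ε) := by
        refine Finset.sum_le_sum fun j _ => ?_
        have : (v ᵥ* A) j = ∑ i, v i * (A i j - ε) := by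
          simp only [mul_sub, Finset.sum_sub_distrib, ← Finset.sum_mul, hv, zero_mul, sub_zero]
          rfl
        rw [this]
        refine (Finset.abs_sum_le_sum_abs _ _).trans_eq (Finset.sum_congr rfl fun i _ => ?_)
        rw [abs_mul, abs_of_nonneg (sub_nonneg.2 (hε i j))]
    _ = (1 - Fintype.card X * ε) * ∑ i, |v i| := by
        rw [Finset.sum_comm, Finset.mul_sum]
        refine Finset.sum_congr rfl fun i _ => ?_
        rw [← Finset.mul_sum, Finset.sum_sub_distrib, sum_row_of_mem_rowStochastic hA]
        simp [mul_comm]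

lemma sum_vecMul_of_mem_rowStochastic (hA : A ∈ rowStochastic ℝ X) (v : X → ℝ) :
    ∑ j, (v ᵥ* A) j = ∑ i, v i := by
  simp only [vecMul, dotProduct]
  rw [Finset.sum_comm]
  refine Finset.sum_congr rfl fun i _ => ?_
  rw [← Finset.mul_sum, sum_row_of_mem_rowStochastic hA, mul_one]

lemma sum_vecMul_pow (hA : A ∈ rowStochastic ℝ X) (v : X → ℝ) (k : ℕ) :
    ∑ j, (v ᵥ* A ^ k) j = ∑ i, v i :=
  sum_vecMul_of_mem_rowStochastic (pow_mem hA k) v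

lemma tendsto_sum_abs_vecMul_pow (hA : A ∈ rowStochastic ℝ X) {n : ℕ}
    (hn : ∀ i j, 0 < (A ^ n) i j) {v : X → ℝ} (hv : ∑ i, v i = 0) :
    Tendsto (fun k => ∑ j, |(v ᵥ* A ^ k) j|) atTop (nhds 0) := by
  rcases isEmpty_or_nonempty X with hX | hX
  · simp
  obtain ⟨p, hp⟩ := Finite.exists_min fun p : X × X => (A ^ n) p.1 p.2
  set ε := (A ^ n) p.1 p.2 with hεdef
  have hε : 0 < ε := hn _ _
  set q := 1 - Fintype.card X * ε with hq
  have hAn : A ^ n ∈ rowStochastic ℝ X := pow_mem hA n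
  have hq0 : 0 ≤ q := by
    have : ∑ j : X, ε ≤ ∑ j, (A ^ n) p.1 j := Finset.sum_le_sum fun j _ => hp (p.1, j)
    rw [sum_row_of_mem_rowStochastic hAn] at this
    simp at this
    linarith
  have hq1 : q < 1 := by
    have : 0 < (Fintype.card X : ℝ) * ε := mul_pos (by exact_mod_cast Fintype.card_pos) hε
    linarith
  -- A stochastic matrix does not expand the `ℓ¹` norm, so the geometric decay along multiples of
  -- `n` carries over to all exponents.
  have hanti : Antitone fun k => ∑ j, |(v ᵥ* A ^ k) j| := by
    refine antitone_nat_of_succ_le fun k => ?_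
    rw [pow_succ, ← vecMul_vecMul]
    exact sum_abs_vecMul_le hA _
  have hgeom : ∀ k : ℕ, ∑ j, |(v ᵥ* A ^ (n * k)) j| ≤ q ^ k * ∑ i, |v i| := by
    intro k
    induction k with
    | zero => simp
    | succ k ih =>
      rw [Nat.mul_succ, pow_add, ← vecMul_vecMul]
      refine (sum_abs_vecMul_le_of_le hAn (fun i j => hp (i, j)) ?_).trans ?_
      · rw [sum_vecMul_pow hA, hv]
      · rw [pow_succ, mul_comm _ q, mul_assoc]
        exact mul_le_mul_of_nonneg_left ih hq0
  have hnonneg : ∀ k, 0 ≤ ∑ j, |(v ᵥ* A ^ k) j| := fun k =>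
    Finset.sum_nonneg fun _ _ => abs_nonneg _
  have hlim : Tendsto (fun k => q ^ k * ∑ i, |v i|) atTop (nhds 0) := by
    simpa using (tendsto_pow_atTop_nhds_zero_of_lt_one hq0 hq1).mul_const (∑ i, |v i|)
  rw [Metric.tendsto_atTop] at hlim ⊢
  intro η hη
  obtain ⟨k, hk⟩ := hlim η hη
  refine ⟨n * k, fun m hm => ?_⟩
  have h1 := hk k le_rfl
  rw [Real.dist_eq, sub_zero] at h1 ⊢
  rw [abs_of_nonneg (hnonneg m)]
  exact (hanti hm).trans_lt ((hgeom k).trans_lt (lt_of_abs_lt h1))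

/-- The rows of the powers of an eventually positive stochastic matrix converge to any stationary
distribution, in the mean and uniformly in the initial state. -/
lemma exists_sum_abs_pow_sub_le (hA : A ∈ rowStochastic ℝ X) {n : ℕ}
    (hn : ∀ i j, 0 < (A ^ n) i j) {p : X → ℝ} (hp : IsStationaryDist A p) {ε : ℝ} (hε : 0 < ε) :
    ∃ T : ℕ, 0 < T ∧ ∀ i, ∑ k ∈ Finset.range T, ∑ j, |(A ^ k) i j - p j| ≤ T * ε := by
  have hpk : ∀ k : ℕ, p ᵥ* A ^ k = p := by
    intro k
    induction k with
    | zero => simp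
    | succ k ih => rw [pow_succ, ← vecMul_vecMul, ih, hp.2]
  have hlim : ∀ i, Tendsto (fun k => ∑ j, |(A ^ k) i j - p j|) atTop (nhds 0) := by
    intro i
    have hv : ∑ j, (Pi.single i (1 : ℝ) - p : X → ℝ) j = 0 := by
      simp [Finset.sum_sub_distrib, hp.1.2]
    refine (tendsto_sum_abs_vecMul_pow hA hn hv).congr fun k => ?_
    refine Finset.sum_congr rfl fun j _ => ?_
    rw [sub_vecMul, hpk, single_one_vecMul]
    rfl
  have hces := fun i => (hlim i).cesaro
  have hev : ∀ᶠ T : ℕ in atTop, ∀ i,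
      (T⁻¹ : ℝ) * ∑ k ∈ Finset.range T, ∑ j, |(A ^ k) i j - p j| < ε :=
    eventually_all.2 fun i => (hces i).eventually_lt_const hε
  obtain ⟨T, hT, hT0⟩ := (hev.and (eventually_gt_atTop 0)).exists
  refine ⟨T, hT0, fun i => ?_⟩
  have hT' : (0 : ℝ) < T := by exact_mod_cast hT0
  have := (hT i).le
  rwa [inv_mul_le_iff₀ hT'] at this

open scoped Kronecker in
lemma kronecker_pow {Y : Type*} [Fintype Y] [DecidableEq Y] (A : Matrix X X ℝ) (B : Matrix Y Y ℝ)
    (k : ℕ) : (A ⊗ₖ B) ^ k = (A ^ k) ⊗ₖ (B ^ k) := by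
  induction k with
  | zero => simp
  | succ k ih => rw [pow_succ, ih, ← mul_kronecker_mul, ← pow_succ, ← pow_succ]

open scoped Kronecker in
lemma kronecker_mem_rowStochastic {Y : Type*} [Fintype Y] [DecidableEq Y] {B : Matrix Y Y ℝ}
    (hA : A ∈ rowStochastic ℝ X) (hB : B ∈ rowStochastic ℝ Y) :
    A ⊗ₖ B ∈ rowStochastic ℝ (X × Y) := by
  rw [mem_rowStochastic_iff_sum]
  refine ⟨fun i j => mul_nonneg (nonneg_of_mem_rowStochastic hA)
    (nonneg_of_mem_rowStochastic hB), fun ⟨i, j⟩ => ?_⟩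
  simp only [Fintype.sum_prod_type, kronecker_apply, ← Finset.mul_sum,
    sum_row_of_mem_rowStochastic hB, mul_one, sum_row_of_mem_rowStochastic hA]

end Matrix

-- The return times of a state are closed under addition and have gcd `1`, so they contain all large
-- integers. A walk of any large length `k` from `i` to `j` is then a loop at `i` followed by a
-- fixed path to `j`.
open Matrix in
lemma IsErgodicChain.exists_pow_pos {X : Type*} [Fintype X] [DecidableEq X] {A : Matrix X X ℝ}
    (h : IsErgodicChain A) : ∃ n, ∀ k ≥ n, ∀ i j, 0 < (A ^ k) i j := by
  have hret : ∀ i, ∃ n, ∀ k ≥ n, 0 < (A ^ k) i i := by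
    intro i
    set s : Set ℕ := {k | 0 < k ∧ 0 < (A ^ k) i i} with hs
    have hgcd : Nat.setGcd s = 1 :=
      h.aperiodic i _ fun k hk hp => Nat.setGcd_dvd_of_mem ⟨hk, hp⟩
    obtain ⟨n, hn⟩ := Nat.exists_mem_closure_of_ge s
    refine ⟨n, fun k hk => ?_⟩
    have hmem := hn k hk (by rw [hgcd]; exact one_dvd k)
    clear hk
    induction hmem using AddSubmonoid.closure_induction with
    | mem x hx => exact hx.2
    | zero => simp
    | add x y _ _ hx hy => exact pow_add_apply_pos h.stochastic hx hy
  choose r hr using hret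
  have hirr := (isIrreducible_iff_exists_pow_pos
    (fun i j => nonneg_of_mem_rowStochastic h.stochastic)).1 h.irreducible
  choose d _ hd using hirr
  refine ⟨∑ i, r i + ∑ i, ∑ j, d i j, fun k hk i j => ?_⟩
  have h1 : r i ≤ ∑ i, r i := Finset.single_le_sum (fun _ _ => Nat.zero_le _) (Finset.mem_univ i)
  have h2 : d i j ≤ ∑ i, ∑ j, d i j :=
    (Finset.single_le_sum (f := fun j => d i j) (fun _ _ => Nat.zero_le _)
      (Finset.mem_univ j)).trans
    (Finset.single_le_sum (f := fun i => ∑ j, d i j) (fun _ _ => Nat.zero_le _)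
      (Finset.mem_univ i))
  have := pow_add_apply_pos h.stochastic (hr i (k - d i j) (by omega)) (hd i j)
  rwa [Nat.sub_add_cancel (by omega)] at this

open Matrix in
open scoped Kronecker in
lemma IsStationaryDist.kronecker {X Y : Type*} [Fintype X] [Fintype Y] {A : Matrix X X ℝ}
    {B : Matrix Y Y ℝ} {p : X → ℝ} {q : Y → ℝ} (hp : IsStationaryDist A p)
    (hq : IsStationaryDist B q) :
    IsStationaryDist (A ⊗ₖ B) fun x : X × Y => p x.1 * q x.2 := by
  refine ⟨⟨fun x => mul_nonneg (hp.1.1 _) (hq.1.1 _), ?_⟩, ?_⟩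
  · simp only [Fintype.sum_prod_type, ← Finset.mul_sum, hq.1.2, mul_one, hp.1.2]
  · ext ⟨x, y⟩
    have h1 := congrFun hp.2 x
    have h2 := congrFun hq.2 y
    simp only [vecMul, dotProduct] at h1 h2 ⊢
    rw [← h1, ← h2, Finset.sum_mul_sum, Fintype.sum_prod_type]
    refine Finset.sum_congr rfl fun a _ => Finset.sum_congr rfl fun b _ => ?_
    rw [kronecker_apply]
    ring

/-! ## Quadratic drift in a finite Markov environment -/

section Markov

variable {Ω ι : Type*}

lemma measurable_comp_of_measurableSet_eq [Finite ι] {m : MeasurableSpace Ω} {X : Ω → ι}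
    (hX : ∀ i, MeasurableSet[m] {ω | X ω = i}) (f : ι → ℝ) : Measurable[m] fun ω => f (X ω) := by
  let : MeasurableSpace ι := ⊤
  have : Measurable[m] X := measurable_to_countable' hX
  exact measurable_from_top.comp this

variable [mΩ : MeasurableSpace Ω] [DecidableEq ι] {μ : Measure Ω} [IsProbabilityMeasure μ]
  {ℱ : Filtration ℕ mΩ} {X : ℕ → Ω → ι} {K : Matrix ι ι ℝ}

lemma Measurable.integrable_of_abs_le {f : Ω → ℝ} (hf : Measurable f) {b : ℝ}
    (hb : ∀ ω, |f ω| ≤ b) : Integrable f μ :=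
  Integrable.of_bound hf.aestronglyMeasurable b (ae_of_all _ hb)

/-- `H` is known at time `t`, so it can be pulled out of the conditional expectation given `ℱ t`. -/
lemma integral_mul_ite_succ
    (hX : ∀ t i, MeasurableSet[ℱ t] {ω | X t ω = i})
    (hK : ∀ t i, μ⟦{ω | X (t + 1) ω = i} | ℱ t⟧ =ᵐ[μ] fun ω => K (X t ω) i)
    {t : ℕ} {H : Ω → ℝ} (hH : Measurable[ℱ t] H) {b : ℝ} (hb : ∀ ω, |H ω| ≤ b) (i : ι) :
    ∫ ω, H ω * (if X (t + 1) ω = i then 1 else 0) ∂μ = ∫ ω, H ω * K (X t ω) i ∂μ := by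
  have hset : MeasurableSet {ω | X (t + 1) ω = i} := ℱ.le _ _ (hX (t + 1) i)
  have hind : Measurable ({ω | X (t + 1) ω = i}.indicator fun _ => (1 : ℝ)) :=
    measurable_const.indicator hset
  have hind1 : ∀ ω, |({ω | X (t + 1) ω = i}.indicator fun _ => (1 : ℝ)) ω| ≤ 1 := by
    intro ω
    by_cases h : X (t + 1) ω = i <;> simp [Set.indicator, h]
  have hHm : Measurable H := hH.mono (ℱ.le t) le_rfl
  have hprod : Integrable (H * {ω | X (t + 1) ω = i}.indicator fun _ => (1 : ℝ)) μ := by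
    refine (hHm.mul hind).integrable_of_abs_le (b := b * 1) fun ω => ?_
    rw [Pi.mul_apply, abs_mul]
    exact mul_le_mul (hb ω) (hind1 ω) (abs_nonneg _) ((abs_nonneg _).trans (hb ω))
  have h1 := condExp_mul_of_stronglyMeasurable_left (μ := μ) hH.stronglyMeasurable hprod
    (hind.integrable_of_abs_le hind1)
  calc ∫ ω, H ω * (if X (t + 1) ω = i then 1 else 0) ∂μ
      = ∫ ω, (H * {ω | X (t + 1) ω = i}.indicator fun _ => (1 : ℝ)) ω ∂μ := by
        refine integral_congr_ae (ae_of_all _ fun ω => ?_)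
        simp [Set.indicator]
    _ = ∫ ω, (μ[H * {ω | X (t + 1) ω = i}.indicator fun _ => (1 : ℝ) | ℱ t]) ω ∂μ :=
        (integral_condExp (ℱ.le t)).symm
    _ = ∫ ω, H ω * K (X t ω) i ∂μ := by
        refine integral_congr_ae ?_
        filter_upwards [h1, hK t i] with ω h1 h2
        rw [h1, Pi.mul_apply, h2]

/-- The `n`-step Markov property in integrated form, tested against quantities known at time `t`;
this avoids iterated conditional expectations. -/
lemma integral_mul_ite_add [Fintype ι]
    (hX : ∀ t i, MeasurableSet[ℱ t] {ω | X t ω = i})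
    (hK : ∀ t i, μ⟦{ω | X (t + 1) ω = i} | ℱ t⟧ =ᵐ[μ] fun ω => K (X t ω) i)
    {t : ℕ} {H : Ω → ℝ} (hH : Measurable[ℱ t] H) {b : ℝ} (hb : ∀ ω, |H ω| ≤ b) (n : ℕ) (i : ι) :
    ∫ ω, H ω * (if X (t + n) ω = i then 1 else 0) ∂μ = ∫ ω, H ω * (K ^ n) (X t ω) i ∂μ := by
  have hHm : Measurable H := hH.mono (ℱ.le t) le_rfl
  have hint : ∀ (u : ℕ) (f : ι → ℝ), Integrable (fun ω => H ω * f (X u ω)) μ := by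
    intro u f
    have hm : Measurable fun ω => f (X u ω) :=
      (measurable_comp_of_measurableSet_eq (hX u) f).mono (ℱ.le u) le_rfl
    refine (hHm.mul hm).integrable_of_abs_le (b := b * ∑ i, |f i|) fun ω => ?_
    rw [Pi.mul_apply, abs_mul]
    exact mul_le_mul (hb ω) (Finset.single_le_sum (f := fun i => |f i|)
      (fun _ _ => abs_nonneg _) (Finset.mem_univ (X u ω))) (abs_nonneg _)
      ((abs_nonneg _).trans (hb ω))
  induction n generalizing i with
  | zero => simp [Matrix.one_apply]
  | succ n ih =>
    rw [← add_assoc, integral_mul_ite_succ hX hK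
      (hH.mono (ℱ.mono (Nat.le_add_right t n)) le_rfl) hb]
    have e1 : ∀ ω, H ω * K (X (t + n) ω) i
        = ∑ k, K k i * (H ω * (if X (t + n) ω = k then 1 else 0)) := fun ω => by
      simp [mul_comm]
    have e2 : ∀ ω, H ω * (K ^ (n + 1)) (X t ω) i
        = ∑ k, K k i * (H ω * (K ^ n) (X t ω) k) := fun ω => by
      rw [pow_succ, Matrix.mul_apply, Finset.mul_sum]
      exact Finset.sum_congr rfl fun k _ => by ring
    simp only [e1, e2]
    rw [integral_finsetSum, integral_finsetSum]
    · refine Finset.sum_congr rfl fun k _ => ?_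
      rw [integral_const_mul, integral_const_mul, ih]
    · exact fun k _ => (hint t fun x => (K ^ n) x k).const_mul _
    · exact fun k _ => (hint (t + n) fun x => if x = k then 1 else 0).const_mul _

end Markov

/-- A nonnegative process `w` whose square has, in the state `i` of the Markov chain `X`, the drift
`2 * F t i` up to a constant, where the average drift in the steady state `p` is at most
`-L * w`. -/
structure QuadraticDrift {Ω ι : Type*} [mΩ : MeasurableSpace Ω] [Fintype ι]
    (K : Matrix ι ι ℝ) (p : ι → ℝ) (M C L : ℝ) (μ : Measure Ω) (ℱ : Filtration ℕ mΩ)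
    (X : ℕ → Ω → ι) (w : ℕ → Ω → ℝ) (F : ℕ → ι → Ω → ℝ) : Prop where
  meas_X : ∀ t i, MeasurableSet[ℱ t] {ω | X t ω = i}
  markov : ∀ t i, μ⟦{ω | X (t + 1) ω = i} | ℱ t⟧ =ᵐ[μ] fun ω => K (X t ω) i
  meas_w : ∀ t, Measurable[ℱ t] (w t)
  meas_F : ∀ t i, Measurable[ℱ t] (F t i)
  nonneg : ∀ t ω, 0 ≤ w t ω
  init : ∃ b, ∀ ω, w 0 ω ≤ b
  jump : ∀ t ω, |w (t + 1) ω - w t ω| ≤ M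
  abs_F : ∀ t i ω, |F t i ω| ≤ M * w t ω
  jump_F : ∀ t i ω, |F (t + 1) i ω - F t i ω| ≤ M
  sq_le : ∀ t ω, w (t + 1) ω ^ 2 ≤ w t ω ^ 2 + 2 * F t (X t ω) ω + C
  mean : ∀ t ω, ∑ i, p i * F t i ω ≤ -L * w t ω

/-- For `w ≥ d`, dropping `(w' - w) ^ 2` from the quadratic bound gives `w' - w ≤ (2 * s + a) / (2 *
w)`, which is inserted in `exp x ≤ 1 + x + x ^ 2` for `|x| ≤ 1`. For `w < d` the bounded jump
suffices. The bound is kept linear in `s`, with a coefficient depending on `w` alone, so that it can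
be integrated. -/
lemma exp_le_of_sq_le {w w' s a r m d : ℝ} (hr : 0 < r) (hd : 0 < d)
    (hm : |w' - w| ≤ m) (hrm : r * m ≤ 1) (hsq : w' ^ 2 ≤ w ^ 2 + 2 * s + a) :
    Real.exp (r * w') ≤ Real.exp (r * (d + m))
      + (if d ≤ w then Real.exp (r * w) * (1 + r ^ 2 * m ^ 2 + r * a / (2 * w)) else 0)
      + (if d ≤ w then r * Real.exp (r * w) / w else 0) * s := by
  have hm0 : 0 ≤ m := (abs_nonneg _).trans hm
  obtain ⟨hm1, hm2⟩ := abs_le.1 hm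
  split_ifs with h
  · have hw : 0 < w := hd.trans_le h
    have hz : |r * (w' - w)| ≤ r * m := by
      rw [abs_mul, abs_of_pos hr]
      exact mul_le_mul_of_nonneg_left hm hr.le
    have h1 := (abs_le.1 (Real.abs_exp_sub_one_sub_id_le (hz.trans hrm))).2
    have h2 : (r * (w' - w)) ^ 2 ≤ r ^ 2 * m ^ 2 := by
      rw [← mul_pow]
      exact sq_le_sq' (by linarith [(abs_le.1 hz).1]) (abs_le.1 hz).2
    have h3 : w' - w ≤ (2 * s + a) / (2 * w) := by
      rw [le_div_iff₀ (by linarith)]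
      nlinarith [sq_nonneg (w' - w)]
    have h4 : r * (w' - w) ≤ r * ((2 * s + a) / (2 * w)) := mul_le_mul_of_nonneg_left h3 hr.le
    have h5 : Real.exp (r * w') = Real.exp (r * w) * Real.exp (r * (w' - w)) := by
      rw [← Real.exp_add]
      ring_nf
    have h6 : Real.exp (r * (w' - w)) ≤ 1 + r * ((2 * s + a) / (2 * w)) + r ^ 2 * m ^ 2 := by
      linarith
    have h7 := mul_le_mul_of_nonneg_left h6 (Real.exp_pos (r * w)).le
    have h8 : Real.exp (r * w) * (1 + r * ((2 * s + a) / (2 * w)) + r ^ 2 * m ^ 2)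
        = Real.exp (r * w) * (1 + r ^ 2 * m ^ 2 + r * a / (2 * w))
          + r * Real.exp (r * w) / w * s := by
      field_simp
      ring
    rw [h5]
    linarith [Real.exp_pos (r * (d + m))]
  · have : Real.exp (r * w') ≤ Real.exp (r * (d + m)) :=
      Real.exp_le_exp.2 (mul_le_mul_of_nonneg_left (by linarith) hr.le)
    linarith

/-! ### Exponential moments under a quadratic drift. -/

namespace QuadraticDrift

variable {Ω ι : Type*} [mΩ : MeasurableSpace Ω] [Fintype ι] {K : Matrix ι ι ℝ} {p : ι → ℝ}
  {M C L : ℝ} {μ : Measure Ω} {ℱ : Filtration ℕ mΩ} {X : ℕ → Ω → ι} {w : ℕ → Ω → ℝ}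
  {F : ℕ → ι → Ω → ℝ}

lemma M_nonneg (h : QuadraticDrift K p M C L μ ℱ X w F) (ω : Ω) : 0 ≤ M :=
  (abs_nonneg _).trans (h.jump 0 ω)

lemma abs_sub_le (h : QuadraticDrift K p M C L μ ℱ X w F) (t n : ℕ) (ω : Ω) :
    |w (t + n) ω - w t ω| ≤ n * M := by
  induction n with
  | zero => simp
  | succ n ih =>
    have h1 := h.jump (t + n) ω
    have h2 := abs_add_le (w (t + n + 1) ω - w (t + n) ω) (w (t + n) ω - w t ω)
    rw [sub_add_sub_cancel] at h2
    push_cast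
    rw [← add_assoc]
    linarith

lemma abs_F_sub_le (h : QuadraticDrift K p M C L μ ℱ X w F) (t n : ℕ) (i : ι) (ω : Ω) :
    |F (t + n) i ω - F t i ω| ≤ n * M := by
  induction n with
  | zero => simp
  | succ n ih =>
    have h1 := h.jump_F (t + n) i ω
    have h2 := abs_add_le (F (t + n + 1) i ω - F (t + n) i ω) (F (t + n) i ω - F t i ω)
    rw [sub_add_sub_cancel] at h2
    push_cast
    rw [← add_assoc]
    linarith

lemma exists_bound (h : QuadraticDrift K p M C L μ ℱ X w F) (t : ℕ) : ∃ b, ∀ ω, w t ω ≤ b := by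
  obtain ⟨b, hb⟩ := h.init
  refine ⟨b + t * M, fun ω => ?_⟩
  have := (abs_le.1 (h.abs_sub_le 0 t ω)).2
  rw [zero_add] at this
  linarith [hb ω]

/-- `F` is frozen at the start of the block, so that afterwards only the chain moves; freezing costs
at most `T * M` per slot. -/
lemma sq_add_le (h : QuadraticDrift K p M C L μ ℱ X w F) (t T : ℕ) (ω : Ω) :
    w (t + T) ω ^ 2 ≤ w t ω ^ 2 + 2 * ∑ n ∈ Finset.range T, F t (X (t + n) ω) ω
      + T * (C + 2 * (T * M)) := by
  have hM := h.M_nonneg ω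
  have key : ∀ k ≤ T, w (t + k) ω ^ 2 ≤ w t ω ^ 2
      + 2 * ∑ n ∈ Finset.range k, F t (X (t + n) ω) ω + k * (C + 2 * (T * M)) := by
    intro k
    induction k with
    | zero => simp
    | succ k ih =>
      intro hk
      have h1 := ih (by omega)
      have h2 := h.sq_le (t + k) ω
      have h3 := (abs_le.1 (h.abs_F_sub_le t k (X (t + k) ω) ω)).2
      have h4 : (k : ℝ) * M ≤ T * M :=
        mul_le_mul_of_nonneg_right (by exact_mod_cast (by omega : k ≤ T)) hM
      rw [Finset.sum_range_succ, ← add_assoc]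
      push_cast
      linarith
  exact key T le_rfl

variable [DecidableEq ι]

/-- The stationary mean contributes `-L * w` per slot, and the deviation from stationarity, averaged
over the block, gives back at most half of it because `|F| ≤ M * w`. -/
lemma sum_mul_pow_le (h : QuadraticDrift K p M C L μ ℱ X w F) {ε : ℝ} {T : ℕ}
    (hT : ∀ i, ∑ k ∈ Finset.range T, ∑ j, |(K ^ k) i j - p j| ≤ T * ε) (hε : M * ε ≤ L / 2)
    (t : ℕ) (i : ι) (ω : Ω) :
    ∑ n ∈ Finset.range T, ∑ j, F t j ω * (K ^ n) i j ≤ -(T * L / 2) * w t ω := by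
  have hw := h.nonneg t ω
  have hM := h.M_nonneg ω
  have h1 : ∀ n, ∑ j, F t j ω * (K ^ n) i j
      ≤ -L * w t ω + M * w t ω * ∑ j, |(K ^ n) i j - p j| := by
    intro n
    have : ∑ j, F t j ω * (K ^ n) i j
        = ∑ j, p j * F t j ω + ∑ j, F t j ω * ((K ^ n) i j - p j) := by
      rw [← Finset.sum_add_distrib]
      exact Finset.sum_congr rfl fun j _ => by ring
    rw [this, Finset.mul_sum]
    refine add_le_add (h.mean t ω) (Finset.sum_le_sum fun j _ => ?_)
    refine (le_abs_self _).trans ?_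
    rw [abs_mul]
    exact mul_le_mul_of_nonneg_right (h.abs_F t j ω) (abs_nonneg _)
  calc ∑ n ∈ Finset.range T, ∑ j, F t j ω * (K ^ n) i j
      ≤ ∑ n ∈ Finset.range T, (-L * w t ω + M * w t ω * ∑ j, |(K ^ n) i j - p j|) :=
        Finset.sum_le_sum fun n _ => h1 n
    _ = -(T * L) * w t ω + M * w t ω * ∑ n ∈ Finset.range T, ∑ j, |(K ^ n) i j - p j| := by
        rw [Finset.sum_add_distrib, Finset.sum_const, Finset.card_range, nsmul_eq_mul,
          Finset.mul_sum]
        ring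
    _ ≤ -(T * L) * w t ω + M * w t ω * (T * ε) := by
        gcongr
        exact hT i
    _ ≤ -(T * L / 2) * w t ω := by
        have : T * w t ω * (M * ε) ≤ T * w t ω * (L / 2) :=
          mul_le_mul_of_nonneg_left hε (by positivity)
        linarith

lemma integral_exp_add_le [IsProbabilityMeasure μ] (h : QuadraticDrift K p M C L μ ℱ X w F)
    {ε : ℝ} {T : ℕ}
    (hT : ∀ i, ∑ k ∈ Finset.range T, ∑ j, |(K ^ k) i j - p j| ≤ T * ε) (hε : M * ε ≤ L / 2)
    (hL : 0 < L) (hC : 0 ≤ C) {r d : ℝ} (hr : 0 < r) (hd : 0 < d) (hrM : r * (T * M) ≤ 1)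
    (hrL : r * (T * M) ^ 2 ≤ T * L / 8) (hdL : C + 2 * (T * M) ≤ d * (L / 2))
    (hrT : r * (T * L / 8) ≤ 1) (t : ℕ) :
    ∫ ω, Real.exp (r * w (t + T) ω) ∂μ
      ≤ (1 - r * (T * L / 8)) * ∫ ω, Real.exp (r * w t ω) ∂μ + Real.exp (r * (d + T * M)) := by
  have hwm : ∀ t, Measurable (w t) := fun t => (h.meas_w t).mono (ℱ.le t) le_rfl
  have hint : ∀ t, Integrable (fun ω => Real.exp (r * w t ω)) μ := by
    intro t
    obtain ⟨b, hb⟩ := h.exists_bound t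
    refine Measurable.integrable_of_abs_le (b := Real.exp (r * b)) (by fun_prop) fun ω => ?_
    rw [Real.abs_exp]
    exact Real.exp_le_exp.2 (mul_le_mul_of_nonneg_left (hb ω) hr.le)
  -- `φ` is the coefficient of the block sum of `F` in `exp_le_of_sq_le`, and `ψ` is the part of
  -- that bound without `F`.
  set φ : Ω → ℝ := fun ω => if d ≤ w t ω then r * Real.exp (r * w t ω) / w t ω else 0 with hφ
  set ψ : Ω → ℝ := fun ω => if d ≤ w t ω then
    Real.exp (r * w t ω) * (1 + r ^ 2 * (T * M) ^ 2
      + r * (T * (C + 2 * (T * M))) / (2 * w t ω)) else 0 with hψ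
  obtain ⟨b, hb⟩ := h.exists_bound t
  have hφm : Measurable[ℱ t] φ := by
    have := h.meas_w t
    refine Measurable.ite (this measurableSet_Ici) ?_ measurable_const
    exact ((measurable_const.mul (Real.measurable_exp.comp (measurable_const.mul this)))).div this
  have hφ0 : ∀ ω, 0 ≤ φ ω := by
    intro ω
    simp only [hφ]
    split_ifs with hw
    · have : 0 < w t ω := hd.trans_le hw
      positivity
    · exact le_rfl
  have hφb : ∀ ω, φ ω ≤ r * Real.exp (r * b) / d := by
    intro ω
    simp only [hφ]
    split_ifs with hw
    · gcongr
      exact hb ω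
    · positivity
  have hFb : ∀ i ω, |φ ω * F t i ω| ≤ r * Real.exp (r * b) / d * (M * b) := by
    intro i ω
    rw [abs_mul, abs_of_nonneg (hφ0 ω)]
    refine mul_le_mul (hφb ω) ((h.abs_F t i ω).trans ?_) (abs_nonneg _)
      ((hφ0 ω).trans (hφb ω))
    exact mul_le_mul_of_nonneg_left (hb ω) (h.M_nonneg ω)
  have hFm : ∀ i, Measurable[ℱ t] fun ω => φ ω * F t i ω := fun i => hφm.mul (h.meas_F t i)
  have hint2 : ∀ (u : ℕ) (i : ι) (f : ι → ℝ),
      Integrable (fun ω => φ ω * F t i ω * f (X u ω)) μ := by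
    intro u i f
    have hm : Measurable fun ω => f (X u ω) :=
      (measurable_comp_of_measurableSet_eq (h.meas_X u) f).mono (ℱ.le u) le_rfl
    refine (((hFm i).mono (ℱ.le t) le_rfl).mul hm).integrable_of_abs_le
      (b := r * Real.exp (r * b) / d * (M * b) * ∑ i, |f i|) fun ω => ?_
    rw [Pi.mul_apply, abs_mul]
    exact mul_le_mul (hFb i ω) (Finset.single_le_sum (f := fun i => |f i|)
      (fun _ _ => abs_nonneg _) (Finset.mem_univ (X u ω))) (abs_nonneg _)
      ((abs_nonneg _).trans (hFb i ω))
  have hψ' : ∀ ω, Real.exp (r * w (t + T) ω) ≤ Real.exp (r * (d + T * M)) + ψ ω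
      + ∑ n ∈ Finset.range T, ∑ j, φ ω * F t j ω * (if X (t + n) ω = j then 1 else 0) := by
    intro ω
    refine (exp_le_of_sq_le hr hd (h.abs_sub_le t T ω) hrM (h.sq_add_le t T ω)).trans_eq ?_
    congr 1
    rw [Finset.mul_sum]
    exact Finset.sum_congr rfl fun n _ => by simp [hφ]
  have hψm : Measurable ψ := by
    have := hwm t
    refine Measurable.ite (this measurableSet_Ici) ?_ measurable_const
    fun_prop
  have hCT : ∀ ω, d ≤ w t ω →
      r * (T * (C + 2 * (T * M))) / (2 * w t ω) ≤ r * (T * L / 4) := by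
    intro ω hw
    have hw0 : 0 < w t ω := hd.trans_le hw
    rw [div_le_iff₀ (by positivity)]
    have h1 : C + 2 * (T * M) ≤ w t ω * (L / 2) :=
      hdL.trans (mul_le_mul_of_nonneg_right hw (by positivity))
    have h2 := mul_le_mul_of_nonneg_left h1 (by positivity : 0 ≤ r * T)
    linarith
  have hψi : Integrable ψ μ := by
    refine hψm.integrable_of_abs_le
      (b := Real.exp (r * b) * (1 + r ^ 2 * (T * M) ^ 2 + r * (T * L / 4))) fun ω => ?_
    have hM := h.M_nonneg ω
    simp only [hψ]
    split_ifs with hw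
    · have hw0 : 0 < w t ω := hd.trans_le hw
      rw [abs_of_nonneg (by positivity)]
      have := hCT ω hw
      gcongr
      exact hb ω
    · rw [abs_zero]
      positivity
  have hdrift : ∀ ω, ψ ω + ∑ n ∈ Finset.range T, ∑ j, φ ω * F t j ω * (K ^ n) (X t ω) j
      ≤ (1 - r * (T * L / 8)) * Real.exp (r * w t ω) := by
    intro ω
    have h1 := mul_le_mul_of_nonneg_left (h.sum_mul_pow_le hT hε t (X t ω) ω) (hφ0 ω)
    have h2 : ∑ n ∈ Finset.range T, ∑ j, φ ω * F t j ω * (K ^ n) (X t ω) j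
        = φ ω * ∑ n ∈ Finset.range T, ∑ j, F t j ω * (K ^ n) (X t ω) j := by
      simp only [Finset.mul_sum, mul_assoc]
    rw [h2]
    refine (add_le_add_right h1 _).trans ?_
    simp only [hψ, hφ]
    split_ifs with hw
    · have hw0 : 0 < w t ω := hd.trans_le hw
      have h3 := hCT ω hw
      have h4 : r ^ 2 * (T * M) ^ 2 ≤ r * (T * L / 8) := by
        rw [pow_two r, mul_assoc]
        exact mul_le_mul_of_nonneg_left hrL hr.le
      have h5 : r * Real.exp (r * w t ω) / w t ω * (-(T * L / 2) * w t ω)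
          = Real.exp (r * w t ω) * (-(r * (T * L / 2))) := by
        field_simp
      rw [h5, ← mul_add, mul_comm]
      refine mul_le_mul_of_nonneg_right ?_ (Real.exp_pos _).le
      -- The drift gains `T * L / 2`; the additive constants use up `T * L / 4` of it and the second
      -- order term `T * L / 8`, which leaves `T * L / 8`.
      linarith
    -- Below `d` the left side vanishes, and `hrT` keeps the contraction factor nonnegative.
    · rw [zero_mul, add_zero]
      exact mul_nonneg (by linarith) (Real.exp_pos _).le
  have hsum : ∀ (u : ℕ → ℕ) (f : ℕ → ι → ι → ℝ), Integrable (fun ω =>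
      ∑ n ∈ Finset.range T, ∑ j, φ ω * F t j ω * f n (X (u n) ω) j) μ := fun u f =>
    integrable_finsetSum _ fun n _ => integrable_finsetSum _ fun j _ =>
      hint2 (u n) j fun x => f n x j
  -- The Markov property enters here: each indicator of `X (t + n)` becomes an `n`-step transition
  -- probability from `X t`.
  have hswap : ∫ ω, ∑ n ∈ Finset.range T, ∑ j,
        φ ω * F t j ω * (if X (t + n) ω = j then 1 else 0) ∂μ
      = ∫ ω, ∑ n ∈ Finset.range T, ∑ j, φ ω * F t j ω * (K ^ n) (X t ω) j ∂μ := by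
    have hi1 : ∀ n j, Integrable
        (fun ω => φ ω * F t j ω * (if X (t + n) ω = j then 1 else 0)) μ := fun n j =>
      hint2 (t + n) j fun x => if x = j then 1 else 0
    have hi2 : ∀ n j, Integrable (fun ω => φ ω * F t j ω * (K ^ n) (X t ω) j) μ := fun n j =>
      hint2 t j fun x => (K ^ n) x j
    rw [integral_finsetSum _ fun n _ => integrable_finsetSum _ fun j _ => hi1 n j,
      integral_finsetSum _ fun n _ => integrable_finsetSum _ fun j _ => hi2 n j]
    refine Finset.sum_congr rfl fun n _ => ?_
    rw [integral_finsetSum _ fun j _ => hi1 n j, integral_finsetSum _ fun j _ => hi2 n j]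
    exact Finset.sum_congr rfl fun j _ =>
      integral_mul_ite_add h.meas_X h.markov (hFm j) (hFb j) n j
  have hi1 := hsum (fun n => t + n) fun _ x j => if x = j then 1 else 0
  have hi2 := hsum (fun _ => t) fun n x j => (K ^ n) x j
  have hc : Integrable (fun _ : Ω => Real.exp (r * (d + T * M))) μ := integrable_const _
  have hcψ : Integrable (fun ω => Real.exp (r * (d + T * M)) + ψ ω) μ := hc.add hψi
  calc ∫ ω, Real.exp (r * w (t + T) ω) ∂μ
      ≤ ∫ ω, (Real.exp (r * (d + T * M)) + ψ ω + ∑ n ∈ Finset.range T, ∑ j,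
          φ ω * F t j ω * (if X (t + n) ω = j then 1 else 0)) ∂μ :=
        integral_mono (hint _) (hcψ.add hi1) hψ'
    _ = ∫ ω, (Real.exp (r * (d + T * M)) + ψ ω + ∑ n ∈ Finset.range T, ∑ j,
          φ ω * F t j ω * (K ^ n) (X t ω) j) ∂μ := by
        rw [integral_add hcψ hi1, integral_add hcψ hi2, hswap]
    _ ≤ ∫ ω, ((1 - r * (T * L / 8)) * Real.exp (r * w t ω) + Real.exp (r * (d + T * M))) ∂μ := by
        refine integral_mono (hcψ.add hi2) (((hint t).const_mul _).add hc) fun ω => ?_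
        have := hdrift ω
        simp only
        linarith
    _ = _ := by
        rw [integral_add ((hint t).const_mul _) hc, integral_const_mul]
        simp

end QuadraticDrift

/-- Summing the recursion shifts the sum by `T` places, which loses only the first `T` terms; a
bound on averages needs no separate treatment of the residue classes modulo `T`. -/
lemma sum_range_le_of_add_le {a : ℕ → ℝ} (ha : ∀ t, 0 ≤ a t) {T : ℕ} {ρ c : ℝ}
    (h : ∀ t, a (t + T) ≤ (1 - ρ) * a t + c) (t : ℕ) :
    ρ * ∑ τ ∈ Finset.range t, a τ ≤ ∑ τ ∈ Finset.range T, a τ + t * c := by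
  have h1 : ∑ τ ∈ Finset.range t, a τ
      ≤ ∑ τ ∈ Finset.range T, a τ + ∑ τ ∈ Finset.range t, a (τ + T) := by
    have : ∑ τ ∈ Finset.range T, a τ + ∑ τ ∈ Finset.range t, a (τ + T)
        = ∑ τ ∈ Finset.range (T + t), a τ := by
      rw [Finset.sum_range_add]
      simp only [add_comm]
    rw [this]
    exact Finset.sum_le_sum_of_subset_of_nonneg
      (Finset.range_subset_range.2 (Nat.le_add_left t T)) fun _ _ _ => ha _
  have h2 : ∑ τ ∈ Finset.range t, a (τ + T) ≤ (1 - ρ) * ∑ τ ∈ Finset.range t, a τ + t * c := by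
    rw [Finset.mul_sum]
    refine (Finset.sum_le_sum fun τ _ => h τ).trans_eq ?_
    rw [Finset.sum_add_distrib, Finset.sum_const, Finset.card_range, nsmul_eq_mul]
  linarith

/-- Exponential attraction from a quadratic drift: the long run frequency of the times at which the
process exceeds `D + k * m` is exponentially small in `m`, with constants that depend only on
those of the drift. -/
theorem exists_exponential_attraction {ι : Type*} [Fintype ι] [DecidableEq ι]
    {K : Matrix ι ι ℝ} {p : ι → ℝ}
    (hK : ∀ ε : ℝ, 0 < ε →
      ∃ T : ℕ, 0 < T ∧ ∀ i, ∑ k ∈ Finset.range T, ∑ j, |(K ^ k) i j - p j| ≤ T * ε)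
    {M C L : ℝ} (hM : 0 < M) (hC : 0 ≤ C) (hL : 0 < L) :
    ∃ D k c : ℝ, 0 < D ∧ 0 < k ∧ 0 < c ∧
      ∀ {Ω : Type*} [mΩ : MeasurableSpace Ω] (μ : Measure Ω) [IsProbabilityMeasure μ]
        (ℱ : Filtration ℕ mΩ) (X : ℕ → Ω → ι) (w : ℕ → Ω → ℝ) (F : ℕ → ι → Ω → ℝ),
        QuadraticDrift K p M C L μ ℱ X w F → ∀ (m : ℝ) (s : ℕ → Set Ω),
        (∀ t, ∀ ω ∈ s t, D + k * m ≤ w t ω) →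
        limsup (fun t : ℕ => (1 / (t : ℝ)) * ∑ τ ∈ Finset.range t, μ.real (s τ)) atTop
          ≤ c * Real.exp (-m) := by
  obtain ⟨T, hT0, hT⟩ := hK (L / (2 * M)) (by positivity)
  have hT0' : (0 : ℝ) < T := by exact_mod_cast hT0
  obtain ⟨r, hr, hr1, hr2, hr3⟩ : ∃ r : ℝ, 0 < r ∧ r * (T * M) ≤ 1 ∧
      r * (T * M) ^ 2 ≤ T * L / 8 ∧ r * (T * L / 8) ≤ 1 := by
    -- The three bounds on `r` serve, in this order, to expand the exponential, to absorb its second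
    -- order term, and to keep the contraction factor nonnegative.
    refine ⟨min (1 / (T * M)) (min ((T * L / 8) / (T * M) ^ 2) (1 / (T * L / 8))),
      by positivity, ?_, ?_, ?_⟩
    · rw [← le_div_iff₀ (by positivity)]
      exact min_le_left _ _
    · rw [← le_div_iff₀ (by positivity)]
      exact (min_le_right _ _).trans (min_le_left _ _)
    · rw [← le_div_iff₀ (by positivity)]
      exact (min_le_right _ _).trans (min_le_right _ _)
  set d := (C + 2 * (T * M)) / (L / 2) with hd
  set ρ := r * (T * L / 8) with hρ
  set b := Real.exp (r * (d + T * M)) with hb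
  have hd0 : 0 < d := by positivity
  have hρ0 : 0 < ρ := by positivity
  have hb0 : 0 < b := Real.exp_pos _
  -- The slope `1 / r` turns `exp (r * w)` into `exp m`; the offset `1` only has to be positive.
  refine ⟨1, 1 / r, 2 * b / ρ, one_pos, by positivity, by positivity, ?_⟩
  intro Ω mΩ μ _ ℱ X w F h m s hs
  set a : ℕ → ℝ := fun t => ∫ ω, Real.exp (r * w t ω) ∂μ with ha
  have hstep : ∀ t, a (t + T) ≤ (1 - ρ) * a t + b := fun t =>
    h.integral_exp_add_le hT (by field_simp; rfl) hL hC hr hd0 hr1 hr2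
      (by rw [hd]; field_simp; rfl) hr3 t
  have ha0 : ∀ t, 0 ≤ a t := fun t => integral_nonneg fun ω => (Real.exp_pos _).le
  have hmarkov : ∀ t, μ.real (s t) ≤ Real.exp (-m) * a t := by
    intro t
    have hint : Integrable (fun ω => Real.exp (r * w t ω)) μ := by
      have hwm : Measurable (w t) := (h.meas_w t).mono (ℱ.le t) le_rfl
      obtain ⟨B, hB⟩ := h.exists_bound t
      refine Measurable.integrable_of_abs_le (b := Real.exp (r * B)) (by fun_prop) fun ω => ?_
      rw [Real.abs_exp]
      exact Real.exp_le_exp.2 (mul_le_mul_of_nonneg_left (hB ω) hr.le)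
    have h1 := mul_meas_ge_le_integral_of_nonneg
      (ae_of_all μ fun ω => (Real.exp_pos (r * w t ω)).le) hint (Real.exp m)
    have h2 : μ.real (s t) ≤ μ.real {ω | Real.exp m ≤ Real.exp (r * w t ω)} := by
      refine measureReal_mono fun ω hω => Real.exp_le_exp.2 ?_
      have := mul_le_mul_of_nonneg_left (hs t ω hω) hr.le
      have e : r * (1 + 1 / r * m) = r + m := by field_simp
      linarith
    have h3 : Real.exp m * μ.real (s t) ≤ a t :=
      (mul_le_mul_of_nonneg_left h2 (Real.exp_pos m).le).trans h1
    rw [Real.exp_neg, ← div_eq_inv_mul, le_div_iff₀ (Real.exp_pos m), mul_comm]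
    exact h3
  have hevent : ∀ᶠ t : ℕ in atTop, (1 / (t : ℝ)) * ∑ τ ∈ Finset.range t, μ.real (s τ)
      ≤ 2 * b / ρ * Real.exp (-m) := by
    -- The first block depends on the initial distance, which is not uniformly bounded. For large
    -- `t` it is at most `t * b`, hence the factor `2` in the constant.
    have hlarge : ∀ᶠ t : ℕ in atTop, ∑ τ ∈ Finset.range T, a τ ≤ t * b := by
      filter_upwards [tendsto_natCast_atTop_atTop.eventually_ge_atTop
        ((∑ τ ∈ Finset.range T, a τ) / b)] with t ht
      rwa [div_le_iff₀ hb0] at ht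
    filter_upwards [hlarge, eventually_gt_atTop 0] with t ht ht0
    have ht0' : (0 : ℝ) < t := by exact_mod_cast ht0
    have h1 := sum_range_le_of_add_le ha0 hstep t
    have h2 : ∑ τ ∈ Finset.range t, a τ ≤ t * (2 * b / ρ) := by
      rw [← mul_div_assoc, le_div_iff₀ hρ0]
      linarith
    rw [one_div, inv_mul_le_iff₀ ht0']
    calc ∑ τ ∈ Finset.range t, μ.real (s τ) ≤ ∑ τ ∈ Finset.range t, Real.exp (-m) * a τ :=
          Finset.sum_le_sum fun τ _ => hmarkov τ
      _ = Real.exp (-m) * ∑ τ ∈ Finset.range t, a τ := by rw [Finset.mul_sum]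
      _ ≤ Real.exp (-m) * (t * (2 * b / ρ)) :=
          mul_le_mul_of_nonneg_left h2 (Real.exp_pos _).le
      _ = t * (2 * b / ρ * Real.exp (-m)) := by ring
  refine limsup_le_of_le ?_ hevent
  -- The real `limsup` is meaningful only for a sequence that does not tend to `-∞`; here the terms
  -- are nonnegative.
  refine isCoboundedUnder_le_of_le atTop (x := 0) fun t => ?_
  exact mul_nonneg (by positivity) (Finset.sum_nonneg fun _ _ => measureReal_nonneg)

/-! ## Euclidean geometry of dual vectors -/

section DualVector

variable {N : Type*}

/-- A dual vector as an element of a Euclidean space. -/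
def dualVec (y : (N → N → ℝ) × (N → ℝ)) : EuclideanSpace ℝ ((N × N) ⊕ N) :=
  WithLp.toLp 2 (Sum.elim (fun p => y.1 p.1 p.2) y.2)

lemma dualVec_sub (y z : (N → N → ℝ) × (N → ℝ)) : dualVec (y - z) = dualVec y - dualVec z := by
  ext i
  rcases i with i | i <;> rfl

variable [Fintype N]

/-- The inner product of dual vectors. -/
def dualDot (y z : (N → N → ℝ) × (N → ℝ)) : ℝ :=
  ∑ n, ∑ c, y.1 n c * z.1 n c + ∑ n, y.2 n * z.2 n

lemma norm_dualVec (y : (N → N → ℝ) × (N → ℝ)) : ‖dualVec y‖ = dualNorm y := by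
  rw [EuclideanSpace.norm_eq, dualNorm]
  simp [dualVec, Fintype.sum_prod_type]

lemma inner_dualVec (y z : (N → N → ℝ) × (N → ℝ)) :
    inner ℝ (dualVec y) (dualVec z) = dualDot y z := by
  simp [PiLp.inner_apply, dualVec, dualDot, Fintype.sum_prod_type, mul_comm]

lemma dualNorm_nonneg (y : (N → N → ℝ) × (N → ℝ)) : 0 ≤ dualNorm y := Real.sqrt_nonneg _

lemma dualNorm_sq (y : (N → N → ℝ) × (N → ℝ)) :
    dualNorm y ^ 2 = (∑ n, ∑ c, y.1 n c ^ 2) + ∑ n, y.2 n ^ 2 :=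
  Real.sq_sqrt (by positivity)

lemma dualNorm_sub_comm (y z : (N → N → ℝ) × (N → ℝ)) : dualNorm (y - z) = dualNorm (z - y) := by
  simp only [← norm_dualVec, dualVec_sub, norm_sub_rev]

lemma abs_dualNorm_sub_le (y z a : (N → N → ℝ) × (N → ℝ)) :
    |dualNorm (y - a) - dualNorm (z - a)| ≤ dualNorm (y - z) := by
  simp only [← norm_dualVec, dualVec_sub]
  refine (abs_norm_sub_norm_le _ _).trans_eq ?_
  rw [sub_sub_sub_cancel_right]

lemma abs_dualDot_le (y z : (N → N → ℝ) × (N → ℝ)) : |dualDot y z| ≤ dualNorm y * dualNorm z := by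
  rw [← inner_dualVec, ← norm_dualVec, ← norm_dualVec]
  exact abs_real_inner_le_norm _ _

lemma dualDot_sub_left (y z a : (N → N → ℝ) × (N → ℝ)) :
    dualDot (y - z) a = dualDot y a - dualDot z a := by
  simp only [← inner_dualVec, dualVec_sub, inner_sub_left]

lemma dualDot_add_right (y z a : (N → N → ℝ) × (N → ℝ)) :
    dualDot y (z + a) = dualDot y z + dualDot y a := by
  simp only [dualDot, Prod.fst_add, Prod.snd_add, Pi.add_apply, mul_add, Finset.sum_add_distrib]
  ring

lemma abs_fst_le_dualNorm (y : (N → N → ℝ) × (N → ℝ)) (n c : N) : |y.1 n c| ≤ dualNorm y := by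
  rw [← norm_dualVec]
  exact PiLp.norm_apply_le (dualVec y) (Sum.inl (n, c))

lemma abs_snd_le_dualNorm (y : (N → N → ℝ) × (N → ℝ)) (n : N) : |y.2 n| ≤ dualNorm y := by
  rw [← norm_dualVec]
  exact PiLp.norm_apply_le (dualVec y) (Sum.inr n)

lemma dualNorm_smul {v : ℝ} (hv : 0 ≤ v) (y : (N → N → ℝ) × (N → ℝ)) :
    dualNorm (v • y) = v * dualNorm y := by
  have : dualVec (v • y) = v • dualVec y := by
    ext i
    rcases i with i | i <;> rfl
  rw [← norm_dualVec, this, norm_smul, norm_dualVec, Real.norm_of_nonneg hv]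

lemma dualNorm_le_of_abs_le {y : (N → N → ℝ) × (N → ℝ)} {b : ℝ} (hb : 0 ≤ b)
    (h1 : ∀ n c, |y.1 n c| ≤ b) (h2 : ∀ n, |y.2 n| ≤ b) :
    dualNorm y ≤ (Fintype.card N + 1) * b := by
  refine Real.sqrt_le_iff.2 ⟨by positivity, ?_⟩
  have e1 : ∑ n, ∑ c, y.1 n c ^ 2 ≤ ∑ _n : N, ∑ _c : N, b ^ 2 :=
    Finset.sum_le_sum fun n _ => Finset.sum_le_sum fun c _ =>
      sq_le_sq' (abs_le.1 (h1 n c)).1 (abs_le.1 (h1 n c)).2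
  have e2 : ∑ n, y.2 n ^ 2 ≤ ∑ _n : N, b ^ 2 :=
    Finset.sum_le_sum fun n _ => sq_le_sq' (abs_le.1 (h2 n)).1 (abs_le.1 (h2 n)).2
  simp only [Finset.sum_const, Finset.card_univ, nsmul_eq_mul] at e1 e2
  have : 0 ≤ (Fintype.card N : ℝ) * b ^ 2 + b ^ 2 := by positivity
  nlinarith

lemma dualNorm_pos {y : (N → N → ℝ) × (N → ℝ)} (hy : y ≠ 0) : 0 < dualNorm y := by
  refine (dualNorm_nonneg y).lt_of_ne fun h => hy ?_
  ext n
  · exact abs_eq_zero.1 (le_antisymm ((abs_fst_le_dualNorm y n _).trans_eq h.symm) (abs_nonneg _))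
  · exact abs_eq_zero.1 (le_antisymm ((abs_snd_le_dualNorm y n).trans_eq h.symm) (abs_nonneg _))

/-- The product type carries the supremum norm, so a Lipschitz bound in `dualNorm` has to be
converted; the purpose is measurability of `slotDual`. -/
lemma continuous_of_abs_sub_le_dualNorm {f : (N → N → ℝ) × (N → ℝ) → ℝ} {M : ℝ}
    (hf : ∀ y z, |f y - f z| ≤ M * dualNorm (y - z)) : Continuous f := by
  refine continuous_iff_continuousAt.2 fun z => ?_
  have h0 : Tendsto (fun y => M * dualNorm (y - z)) (nhds z) (nhds 0) := by
    have hc : Continuous fun y : (N → N → ℝ) × (N → ℝ) => M * dualNorm (y - z) := by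
      unfold dualNorm
      fun_prop
    have := hc.tendsto z
    simpa [dualNorm] using this
  rw [ContinuousAt, tendsto_iff_dist_tendsto_zero]
  exact squeeze_zero (fun _ => dist_nonneg) (fun y => hf y z) h0

/-! ## Suprema of affine functions of the dual vector -/

/-- The supremum over `x ∈ s` of the affine functions `y ↦ u x - ⟪y, b x⟫`. -/
def supAffine {α : Type*} (s : Set α) (u : α → ℝ) (b : α → (N → N → ℝ) × (N → ℝ))
    (y : (N → N → ℝ) × (N → ℝ)) : ℝ :=
  sSup ((fun x => u x - dualDot y (b x)) '' s)

variable {α : Type*} {s : Set α} {u : α → ℝ} {b : α → (N → N → ℝ) × (N → ℝ)} {B M : ℝ}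

lemma le_supAffine (hu : ∀ x ∈ s, u x ≤ B) (hb : ∀ x ∈ s, dualNorm (b x) ≤ M)
    (y : (N → N → ℝ) × (N → ℝ)) {x : α} (hx : x ∈ s) :
    u x - dualDot y (b x) ≤ supAffine s u b y := by
  refine le_csSup ⟨B + dualNorm y * M, ?_⟩ (Set.mem_image_of_mem _ hx)
  rintro _ ⟨z, hz, rfl⟩
  have h1 := neg_le_of_abs_le (abs_dualDot_le y (b z))
  have h2 := mul_le_mul_of_nonneg_left (hb z hz) (dualNorm_nonneg y)
  have h3 := hu z hz
  simp only
  linarith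

lemma supAffine_le (hs : s.Nonempty) {y : (N → N → ℝ) × (N → ℝ)} {a : ℝ}
    (h : ∀ x ∈ s, u x - dualDot y (b x) ≤ a) : supAffine s u b y ≤ a :=
  csSup_le (hs.image _) (by rintro _ ⟨x, hx, rfl⟩; exact h x hx)

lemma exists_lt_of_supAffine (hs : s.Nonempty) (y : (N → N → ℝ) × (N → ℝ)) {ε : ℝ} (hε : 0 < ε) :
    ∃ x ∈ s, supAffine s u b y - ε < u x - dualDot y (b x) := by
  obtain ⟨_, ⟨x, hx, rfl⟩, h⟩ := exists_lt_of_lt_csSup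
    (hs.image fun x => u x - dualDot y (b x)) (sub_lt_self _ hε)
  exact ⟨x, hx, h⟩

/-- The Lipschitz constant involves only the slopes `b x`; the bound `B` on the constant terms just
makes the supremum finite. -/
lemma abs_supAffine_sub_le (hs : s.Nonempty) (hu : ∀ x ∈ s, u x ≤ B)
    (hb : ∀ x ∈ s, dualNorm (b x) ≤ M) (y z : (N → N → ℝ) × (N → ℝ)) :
    |supAffine s u b y - supAffine s u b z| ≤ M * dualNorm (y - z) := by
  have key : ∀ y z, supAffine s u b y - supAffine s u b z ≤ M * dualNorm (y - z) := by
    intro y z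
    rw [sub_le_iff_le_add]
    refine supAffine_le hs fun x hx => ?_
    have h1 := le_supAffine hu hb z hx
    have h2 := neg_le_of_abs_le (abs_dualDot_le (y - z) (b x))
    have h3 := mul_le_mul_of_nonneg_left (hb x hx) (dualNorm_nonneg (y - z))
    rw [dualDot_sub_left] at h2
    linarith
  refine abs_le.2 ⟨?_, key y z⟩
  have := key z y
  rw [dualNorm_sub_comm] at this
  linarith

end DualVector

namespace EnergyNetwork

variable {N S J : Type*} [Fintype N] [DecidableEq N] (G : EnergyNetwork N S J)

lemma sum_mul_outSum (y : N → ℝ) (f : G.links → ℝ) :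
    ∑ n, y n * G.outSum f n = ∑ l : G.links, y l.1.1 * f l := by
  simp only [outSum, Finset.mul_sum, Finset.sum_filter, mul_ite, mul_zero]
  rw [Finset.sum_comm]
  simp

lemma sum_mul_inSum (y : N → ℝ) (f : G.links → ℝ) :
    ∑ n, y n * G.inSum f n = ∑ l : G.links, y l.1.2 * f l := by
  simp only [inSum, Finset.mul_sum, Finset.sum_filter, mul_ite, mul_zero]
  rw [Finset.sum_comm]
  simp

/-! ## Decomposition of the dual function -/

/-- The feasible admission decisions. -/
def admissions : Set (N → N → ℝ) := {r | ∀ n c, r n c ∈ Set.Icc 0 G.Rmax}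

/-- The feasible powers and splits of the link rates in channel state `s`. -/
def transmissions (s : S) : Set ((G.links → ℝ) × (G.links → N → ℝ)) :=
  {x | x.1 ∈ G.power s ∧ (∀ l c, 0 ≤ x.2 l c) ∧ ∀ l, ∑ c, x.2 l c ≤ G.rate s x.1 l}

/-- The feasible harvesting decisions in energy state `j`. -/
def harvests (j : J) : Set (N → ℝ) := {e | ∀ n, e n ∈ Set.Icc 0 (G.harvest j n)}

/-- The contribution of an admission decision to the queue increments. -/
def admissionDrift (r : N → N → ℝ) : (N → N → ℝ) × (N → ℝ) := (r, 0)

/-- The contribution of a transmission decision to the queue increments. -/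
def transmissionDrift (x : (G.links → ℝ) × (G.links → N → ℝ)) : (N → N → ℝ) × (N → ℝ) :=
  (fun n c => G.inSum (fun l => x.2 l c) n - G.outSum (fun l => x.2 l c) n, G.outSum x.1)

/-- The contribution of a harvesting decision to the queue increments. -/
def harvestDrift (e : N → ℝ) : (N → N → ℝ) × (N → ℝ) := (0, -e)

/-- The part of the dual function that is due to admission. -/
def admissionDual (V : ℝ) : (N → N → ℝ) × (N → ℝ) → ℝ :=
  supAffine G.admissions (fun r => V * ∑ n, ∑ c, G.U n c (r n c)) admissionDrift

/-- The part of the dual function that is due to transmission in channel state `s`. -/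
def transmissionDual (s : S) : (N → N → ℝ) × (N → ℝ) → ℝ :=
  supAffine (G.transmissions s) (fun _ => 0) G.transmissionDrift

/-- The part of the dual function that is due to harvesting in energy state `j`. -/
def harvestDual (j : J) : (N → N → ℝ) × (N → ℝ) → ℝ :=
  supAffine (G.harvests j) (fun _ => 0) harvestDrift

/-- The dual function of a single slot. -/
def slotDual (V : ℝ) (i : S × J) (y : (N → N → ℝ) × (N → ℝ)) : ℝ :=
  G.admissionDual V y + G.transmissionDual i.1 y + G.harvestDual i.2 y

lemma admissions_nonempty : G.admissions.Nonempty :=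
  ⟨0, fun _ _ => ⟨le_rfl, G.Rmax_nonneg⟩⟩

lemma transmissions_nonempty (s : S) : (G.transmissions s).Nonempty := by
  obtain ⟨P, hP⟩ := G.power_nonempty s
  exact ⟨(P, 0), hP, fun _ _ => le_rfl, fun l => by simpa using G.rate_nonneg s P hP l⟩

lemma harvests_nonempty (j : J) : (G.harvests j).Nonempty :=
  ⟨0, fun n => ⟨le_rfl, G.harvest_nonneg j n⟩⟩

/-- A bound on the increment of every queue in a slot. -/
def incrBound [Fintype J] : ℝ :=
  G.Rmax + 2 * (Fintype.card G.links * |G.μmax|) + |G.Pmax| + ∑ j, ∑ n, G.harvest j n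

/-! ### Increment bounds and the Lipschitz constant of the slot dual. -/

section Bounds

variable {G}

lemma outSum_nonneg {f : G.links → ℝ} (hf : ∀ l, 0 ≤ f l) (n : N) : 0 ≤ G.outSum f n :=
  Finset.sum_nonneg fun l _ => hf l

lemma inSum_nonneg {f : G.links → ℝ} (hf : ∀ l, 0 ≤ f l) (n : N) : 0 ≤ G.inSum f n :=
  Finset.sum_nonneg fun l _ => hf l

lemma sum_le_card_mul {f : G.links → ℝ} {a : ℝ} (h : ∀ l, f l ≤ a) :
    ∑ l, f l ≤ Fintype.card G.links * a := by
  refine (Finset.sum_le_sum fun l _ => h l).trans_eq ?_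
  rw [Finset.sum_const, Finset.card_univ, nsmul_eq_mul]

lemma outSum_le {f : G.links → ℝ} {a : ℝ} (hf : ∀ l, 0 ≤ f l) (h : ∀ l, f l ≤ a) (n : N) :
    G.outSum f n ≤ Fintype.card G.links * a :=
  (Finset.sum_le_sum_of_subset_of_nonneg (Finset.filter_subset _ _) fun l _ _ => hf l).trans
    (sum_le_card_mul h)

lemma inSum_le {f : G.links → ℝ} {a : ℝ} (hf : ∀ l, 0 ≤ f l) (h : ∀ l, f l ≤ a) (n : N) :
    G.inSum f n ≤ Fintype.card G.links * a :=
  (Finset.sum_le_sum_of_subset_of_nonneg (Finset.filter_subset _ _) fun l _ _ => hf l).trans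
    (sum_le_card_mul h)

lemma split_le_abs {s : S} {x : (G.links → ℝ) × (G.links → N → ℝ)} (hx : x ∈ G.transmissions s)
    (l : G.links) (c : N) : x.2 l c ≤ |G.μmax| :=
  (Finset.single_le_sum (fun c _ => hx.2.1 l c) (Finset.mem_univ c)).trans
    ((hx.2.2 l).trans ((G.rate_le s x.1 hx.1 l).trans (le_abs_self _)))

lemma utility_le {V : ℝ} (hV : 0 ≤ V) {r : N → N → ℝ} (hr : r ∈ G.admissions) :
    V * ∑ n, ∑ c, G.U n c (r n c) ≤ V * ∑ n, ∑ c, G.U n c G.Rmax :=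
  mul_le_mul_of_nonneg_left (Finset.sum_le_sum fun n _ => Finset.sum_le_sum fun c _ =>
    G.U_mono n c (hr n c).1 G.Rmax_nonneg (hr n c).2) hV

variable [Fintype J]

lemma harvest_le_sum (j : J) (n : N) : G.harvest j n ≤ ∑ j, ∑ n, G.harvest j n :=
  (Finset.single_le_sum (f := fun n => G.harvest j n) (fun n _ => G.harvest_nonneg j n)
    (Finset.mem_univ n)).trans
  (Finset.single_le_sum (f := fun j => ∑ n, G.harvest j n)
    (fun j _ => Finset.sum_nonneg fun n _ => G.harvest_nonneg j n) (Finset.mem_univ j))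

lemma sum_harvest_nonneg : 0 ≤ ∑ j, ∑ n, G.harvest j n :=
  Finset.sum_nonneg fun j _ => Finset.sum_nonneg fun n _ => G.harvest_nonneg j n

lemma incrBound_nonneg : 0 ≤ G.incrBound := by
  have := G.Rmax_nonneg
  have := sum_harvest_nonneg (G := G)
  unfold incrBound
  positivity

lemma dualNorm_admissionDrift_le {r : N → N → ℝ} (hr : r ∈ G.admissions) :
    dualNorm (admissionDrift r) ≤ (Fintype.card N + 1) * G.incrBound := by
  refine dualNorm_le_of_abs_le incrBound_nonneg (fun n c => ?_) fun n => ?_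
  · have h1 := (hr n c).2
    have h2 := sum_harvest_nonneg (G := G)
    rw [admissionDrift, abs_of_nonneg (hr n c).1, incrBound]
    have : 0 ≤ 2 * (Fintype.card G.links * |G.μmax|) + |G.Pmax| := by positivity
    linarith
  · simpa [admissionDrift] using incrBound_nonneg

lemma dualNorm_transmissionDrift_le {s : S} {x : (G.links → ℝ) × (G.links → N → ℝ)}
    (hx : x ∈ G.transmissions s) :
    dualNorm (G.transmissionDrift x) ≤ (Fintype.card N + 1) * G.incrBound := by
  have h0 := G.Rmax_nonneg
  have h1 := sum_harvest_nonneg (G := G)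
  have h2 : 0 ≤ Fintype.card G.links * |G.μmax| := by positivity
  have h3 := abs_nonneg G.Pmax
  refine dualNorm_le_of_abs_le incrBound_nonneg (fun n c => ?_) fun n => ?_
  · have h4 := inSum_nonneg (fun l => hx.2.1 l c) n
    have h5 := outSum_nonneg (fun l => hx.2.1 l c) n
    have h6 := inSum_le (fun l => hx.2.1 l c) (fun l => split_le_abs hx l c) n
    have h7 := outSum_le (fun l => hx.2.1 l c) (fun l => split_le_abs hx l c) n
    simp only [transmissionDrift, incrBound]
    exact abs_le.2 ⟨by linarith, by linarith⟩
  · have h4 := outSum_nonneg (G.power_nonneg s x.1 hx.1) n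
    have h5 : G.outSum x.1 n ≤ G.Pmax := G.power_le s x.1 hx.1 n
    have h6 := le_abs_self G.Pmax
    simp only [transmissionDrift, incrBound]
    exact abs_le.2 ⟨by linarith, by linarith⟩

lemma dualNorm_harvestDrift_le {j : J} {e : N → ℝ} (he : e ∈ G.harvests j) :
    dualNorm (harvestDrift e) ≤ (Fintype.card N + 1) * G.incrBound := by
  refine dualNorm_le_of_abs_le incrBound_nonneg (fun n c => ?_) fun n => ?_
  · simpa [harvestDrift] using incrBound_nonneg
  · have h1 := (he n).2
    have h2 := harvest_le_sum (G := G) j n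
    have h3 := G.Rmax_nonneg
    simp only [harvestDrift, Pi.neg_apply, abs_neg]
    rw [abs_of_nonneg (he n).1, incrBound]
    have : 0 ≤ 2 * (Fintype.card G.links * |G.μmax|) + |G.Pmax| := by positivity
    linarith

/-- The constant does not involve `V`, since `V` scales the utilities but not the slopes. The
uniformity of the theorem in `V` rests on this. -/
lemma abs_slotDual_sub_le {V : ℝ} (hV : 0 ≤ V) (i : S × J) (y z : (N → N → ℝ) × (N → ℝ)) :
    |G.slotDual V i y - G.slotDual V i z|
      ≤ 3 * ((Fintype.card N + 1) * G.incrBound) * dualNorm (y - z) := by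
  have h1 := abs_supAffine_sub_le G.admissions_nonempty (fun r hr => utility_le hV hr)
    (fun r hr => dualNorm_admissionDrift_le hr) y z
  have h2 := abs_supAffine_sub_le (u := fun _ => 0) (G.transmissions_nonempty i.1) (fun _ _ => le_rfl)
    (fun x hx => dualNorm_transmissionDrift_le hx) y z
  have h3 := abs_supAffine_sub_le (u := fun _ => 0) (G.harvests_nonempty i.2) (fun _ _ => le_rfl)
    (fun e he => dualNorm_harvestDrift_le he) y z
  rw [abs_le] at h1 h2 h3 ⊢
  unfold slotDual admissionDual transmissionDual harvestDual
  constructor <;> linarith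

end Bounds

variable [Fintype S] [Fintype J] {G}

lemma sum_mul_sum_mul_add {p : S → ℝ} {q : J → ℝ} (hp : ∑ s, p s = 1) (hq : ∑ j, q j = 1)
    (a : ℝ) (f : S → ℝ) (g : J → ℝ) :
    ∑ s, p s * ∑ j, q j * (a + f s + g j) = a + ∑ s, p s * f s + ∑ j, q j * g j := by
  simp only [mul_add, Finset.sum_add_distrib, ← Finset.sum_mul, hp, hq, one_mul]

lemma lagrangian_eq {πS : S → ℝ} {πJ : J → ℝ} (hS : ∑ s, πS s = 1) (hJ : ∑ j, πJ j = 1)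
    (V : ℝ) (y : (N → N → ℝ) × (N → ℝ)) (x : G.Decision) :
    G.lagrangian πS πJ V y x
      = (V * ∑ n, ∑ c, G.U n c (x.r n c) - dualDot y (admissionDrift x.r))
        + ∑ s, πS s * (0 - dualDot y (G.transmissionDrift (x.P s, x.split s)))
        + ∑ j, πJ j * (0 - dualDot y (harvestDrift (x.e j))) := by
  rw [← sum_mul_sum_mul_add hS hJ, lagrangian]
  refine Finset.sum_congr rfl fun s _ => ?_
  congr 1
  refine Finset.sum_congr rfl fun j _ => ?_
  congr 1
  simp only [dualDot, admissionDrift, transmissionDrift, harvestDrift, Pi.zero_apply, mul_zero,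
    Finset.sum_const_zero, add_zero, zero_add, Pi.neg_apply, mul_neg, Finset.sum_neg_distrib,
    mul_sub, mul_add, Finset.sum_add_distrib, Finset.sum_sub_distrib]
  ring

/-- The dual function is the mean of the single slot dual functions. -/
lemma dual_eq {πS : S → ℝ} {πJ : J → ℝ} (hS : πS ∈ stdSimplex ℝ S) (hJ : πJ ∈ stdSimplex ℝ J)
    {V : ℝ} (hV : 0 ≤ V) (y : (N → N → ℝ) × (N → ℝ)) :
    G.dual πS πJ V y
      = G.admissionDual V y + ∑ s, πS s * G.transmissionDual s y
        + ∑ j, πJ j * G.harvestDual j y := by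
  have hub : ∀ a ∈ G.lagrangian πS πJ V y '' {x | x.Feasible}, a
      ≤ G.admissionDual V y + ∑ s, πS s * G.transmissionDual s y
        + ∑ j, πJ j * G.harvestDual j y := by
    rintro _ ⟨x, hx, rfl⟩
    rw [lagrangian_eq hS.2 hJ.2]
    refine add_le_add (add_le_add ?_ (Finset.sum_le_sum fun s _ =>
      mul_le_mul_of_nonneg_left ?_ (hS.1 s))) (Finset.sum_le_sum fun j _ =>
      mul_le_mul_of_nonneg_left ?_ (hJ.1 j))
    · exact le_supAffine (s := G.admissions) (fun r hr => utility_le hV hr)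
        (fun r hr => dualNorm_admissionDrift_le hr) y hx.r_mem
    · exact le_supAffine (s := G.transmissions s) (fun _ _ => le_rfl)
        (fun x hx => dualNorm_transmissionDrift_le hx) y (x := (x.P s, x.split s))
        ⟨hx.P_mem s, hx.split_nonneg s, hx.split_le s⟩
    · exact le_supAffine (s := G.harvests j) (fun _ _ => le_rfl)
        (fun e he => dualNorm_harvestDrift_le he) y (hx.e_mem j)
  -- The variables separate, so near-maximizers can be chosen independently for admission, for each
  -- channel state and for each energy state. Each of the three groups loses at most `ε`, as the
  -- weights sum to `1`; no maximum need be attained.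
  have hnear : ∀ ε : ℝ, 0 < ε → ∃ x : G.Decision, x.Feasible ∧
      G.admissionDual V y + ∑ s, πS s * G.transmissionDual s y + ∑ j, πJ j * G.harvestDual j y
        ≤ G.lagrangian πS πJ V y x + 3 * ε := by
    intro ε hε
    obtain ⟨r, hr, hr'⟩ := exists_lt_of_supAffine (u := fun r => V * ∑ n, ∑ c, G.U n c (r n c))
      (b := admissionDrift) G.admissions_nonempty y hε
    choose x hx hx' using fun s => exists_lt_of_supAffine (u := fun _ => 0)
      (b := G.transmissionDrift) (G.transmissions_nonempty s) y hε
    choose e he he' using fun j => exists_lt_of_supAffine (u := fun _ => 0)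
      (b := harvestDrift) (G.harvests_nonempty j) y hε
    refine ⟨⟨r, fun s => (x s).1, fun s => (x s).2, e⟩, ⟨hr, fun s => (hx s).1,
      fun s => (hx s).2.1, fun s => (hx s).2.2, he⟩, ?_⟩
    rw [lagrangian_eq hS.2 hJ.2]
    have h1 : ∑ s, πS s * (G.transmissionDual s y - ε)
        ≤ ∑ s, πS s * (0 - dualDot y (G.transmissionDrift (x s))) :=
      Finset.sum_le_sum fun s _ => mul_le_mul_of_nonneg_left (hx' s).le (hS.1 s)
    have h2 : ∑ j, πJ j * (G.harvestDual j y - ε)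
        ≤ ∑ j, πJ j * (0 - dualDot y (harvestDrift (e j))) :=
      Finset.sum_le_sum fun j _ => mul_le_mul_of_nonneg_left (he' j).le (hJ.1 j)
    simp only [mul_sub _ _ ε, Finset.sum_sub_distrib, ← Finset.sum_mul, hS.2, hJ.2, one_mul] at h1 h2
    have h3 : G.admissionDual V y - ε < _ := hr'
    simp only [Prod.mk.eta]
    linarith
  refine le_antisymm (csSup_le ?_ hub) (le_of_forall_pos_le_add fun ε hε => ?_)
  · obtain ⟨x, hx, _⟩ := hnear 1 one_pos
    exact ⟨_, x, hx, rfl⟩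
  · obtain ⟨x, hx, h⟩ := hnear (ε / 3) (by positivity)
    have : G.lagrangian πS πJ V y x ≤ G.dual πS πJ V y := le_csSup ⟨_, hub⟩ ⟨x, hx, rfl⟩
    linarith

lemma dual_eq_sum_slotDual {πS : S → ℝ} {πJ : J → ℝ} (hS : πS ∈ stdSimplex ℝ S)
    (hJ : πJ ∈ stdSimplex ℝ J) {V : ℝ} (hV : 0 ≤ V) (y : (N → N → ℝ) × (N → ℝ)) :
    G.dual πS πJ V y = ∑ i : S × J, πS i.1 * πJ i.2 * G.slotDual V i y := by
  rw [dual_eq hS hJ hV, ← sum_mul_sum_mul_add hS.2 hJ.2, Fintype.sum_prod_type]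
  simp only [Finset.mul_sum, mul_assoc]
  rfl

lemma dual_smul {πS : S → ℝ} {πJ : J → ℝ} {V : ℝ} (hV : 0 ≤ V) (y : (N → N → ℝ) × (N → ℝ)) :
    G.dual πS πJ V (V • y) = V * G.dual πS πJ 1 y := by
  have : G.lagrangian πS πJ V (V • y) = fun x => V • G.lagrangian πS πJ 1 y x := by
    ext x
    simp only [lagrangian, Finset.mul_sum, smul_eq_mul, Prod.smul_fst, Prod.smul_snd,
      Pi.smul_apply, one_mul]
    refine Finset.sum_congr rfl fun s _ => Finset.sum_congr rfl fun j _ => ?_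
    simp only [mul_assoc, ← Finset.mul_sum]
    ring
  rw [dual, this, dual, ← smul_eq_mul V (sSup _), ← Real.sSup_smul_of_nonneg hV]
  rw [← Set.image_smul, Set.image_image]

end EnergyNetwork

namespace EnergyNetwork

variable {N S J : Type*} [Fintype N] [DecidableEq N] {G : EnergyNetwork N S J}

/-! ## Constants of the network -/

/-- A concave function vanishing at `0` lies below its tangent there. -/
lemma utility_le_mul (n c : N) {r : ℝ} (hr : 0 ≤ r) : G.U n c r ≤ G.β * r := by
  rcases hr.eq_or_lt with rfl | hr
  · simp [G.U_zero]
  · have h1 := (G.U_concave n c).slope_le_derivWithin (Set.self_mem_Ici) hr.le hr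
      ((G.U_contDiff n c).differentiableOn one_ne_zero 0 Set.self_mem_Ici)
    have h2 : derivWithin (G.U n c) (Set.Ici 0) 0 ≤ G.β :=
      le_ciSup (f := fun p : N × N => derivWithin (G.U p.1 p.2) (Set.Ici 0) 0)
        (Set.finite_range _).bddAbove (n, c)
    have h3 := h1.trans h2
    rw [slope_def_field, G.U_zero, sub_zero, sub_zero, div_le_iff₀ hr] at h3
    exact h3

lemma β_nonneg (n : N) : 0 ≤ G.β := by
  have h1 := utility_le_mul (G := G) n n zero_le_one
  have h2 := G.U_mono n n Set.self_mem_Ici (zero_le_one (α := ℝ)) zero_le_one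
  rw [G.U_zero] at h2
  linarith

lemma μmax_nonneg (s : S) (l : G.links) : 0 ≤ G.μmax := by
  obtain ⟨P, hP⟩ := G.power_nonempty s
  exact (G.rate_nonneg s P hP l).trans (G.rate_le s P hP l)

/-- Without links `μmax` may be negative, but then `dmax` is `0`. -/
lemma dmax_mul_μmax_nonneg (s : S) : 0 ≤ G.dmax * G.μmax := by
  rcases isEmpty_or_nonempty G.links with h | ⟨⟨l⟩⟩
  · have : G.links = ∅ := Finset.isEmpty_coe_sort.1 h
    have hd : G.dmax = 0 := Nat.le_zero.1 (Finset.sup_le fun n _ => by simp [this])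
    simp [hd]
  · exact mul_nonneg (Nat.cast_nonneg _) (μmax_nonneg s l)

lemma γ_nonneg (s : S) : 0 ≤ G.γ := add_nonneg G.Rmax_nonneg (dmax_mul_μmax_nonneg s)

lemma inSum_le_dmax_mul (s : S) {f : G.links → ℝ} (hf : ∀ l, f l ≤ G.μmax) (n : N) :
    G.inSum f n ≤ G.dmax * G.μmax := by
  rcases isEmpty_or_nonempty G.links with h | ⟨⟨l⟩⟩
  · simpa [inSum] using dmax_mul_μmax_nonneg (G := G) s
  · refine (Finset.sum_le_sum fun l _ => hf l).trans ?_
    rw [Finset.sum_const, nsmul_eq_mul]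
    refine mul_le_mul_of_nonneg_right ?_ (μmax_nonneg s l)
    have h1 : (Finset.univ.filter fun l : G.links => l.1.2 = n).card
        ≤ (G.links.filter fun l => l.2 = n).card := by
      refine Finset.card_le_card_of_injOn Subtype.val (fun x hx => ?_) Subtype.val_injective.injOn
      have := (Finset.mem_filter.1 hx).2
      exact Finset.mem_filter.2 ⟨x.2, this⟩
    have h2 : (G.links.filter fun l => l.2 = n).card ≤ G.dmax :=
      Finset.le_sup (f := fun n : N => (G.links.filter fun l => l.2 = n).card) (Finset.mem_univ n)
    exact_mod_cast h1.trans h2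

lemma weight_le_linkWeight (Q : N → N → ℝ) (l : G.links) (c : N) :
    G.weight Q l c ≤ G.linkWeight Q l :=
  le_ciSup (f := fun c => G.weight Q l c) (Set.finite_range _).bddAbove c

lemma linkWeight_nonneg (Q : N → N → ℝ) (l : G.links) : 0 ≤ G.linkWeight Q l :=
  (le_max_right _ _).trans (weight_le_linkWeight Q l l.1.1)

lemma powerObjective_eq (θ : N → ℝ) (s : S) (Q : N → N → ℝ) (E : N → ℝ) (P : G.links → ℝ) :
    G.powerObjective θ s Q E P
      = ∑ l, (G.rate s P l * G.linkWeight Q l + (E l.1.1 - θ l.1.1) * P l) := by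
  rw [powerObjective, Finset.sum_add_distrib, Finset.sum_add_distrib,
    sum_mul_outSum G (fun n => E n - θ n)]
  have := sum_mul_outSum G (fun _ => 1) fun l => G.rate s P l * G.linkWeight Q l
  simp only [one_mul] at this
  rw [this]

/-! ## The energy availability constraint -/

/-- Switching off `l` loses weighted rate at most `δ * b * P l`, saves an energy cost of at least
that much, and does not lower the rates of the other links. -/
lemma powerObjective_le_update {θ : N → ℝ} {s : S} {Q : N → N → ℝ} {E : N → ℝ} {b : ℝ}
    {P : G.links → ℝ} (hP : P ∈ G.power s) {l : G.links} (hb : G.linkWeight Q l ≤ b)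
    (hE : E l.1.1 - θ l.1.1 ≤ -(G.δ * b)) :
    G.powerObjective θ s Q E P ≤ G.powerObjective θ s Q E (Function.update P l 0) := by
  rw [powerObjective_eq, powerObjective_eq]
  refine Finset.sum_le_sum fun k _ => ?_
  have hW := linkWeight_nonneg Q k
  rcases eq_or_ne k l with rfl | hkl
  · rw [Function.update_self, mul_zero, add_zero]
    have hPk := G.power_nonneg s P hP k
    have h1 := mul_le_mul_of_nonneg_right (G.rate_own s P hP k) hW
    have h2 := mul_le_mul_of_nonneg_right hE hPk
    have h3 : G.δ * P k * G.linkWeight Q k ≤ G.δ * P k * b :=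
      mul_le_mul_of_nonneg_left hb (mul_nonneg G.δ_pos.le hPk)
    linarith
  · rw [Function.update_of_ne hkl]
    have := mul_le_mul_of_nonneg_right (G.rate_other s P hP l k hkl) hW
    linarith

/-- Nodes that are short of energy may be switched off, so the energy availability constraint does
not affect the maximal power objective. -/
lemma exists_availablePower {θ : N → ℝ} {s : S} {Q : N → N → ℝ} {E : N → ℝ} {b : ℝ}
    (hE : ∀ n, 0 ≤ E n) (hθ : ∀ n, G.δ * b + G.Pmax ≤ θ n) (hb : ∀ l, G.linkWeight Q l ≤ b)
    {P : G.links → ℝ} (hP : P ∈ G.power s) :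
    ∃ P' ∈ G.availablePower s E, G.powerObjective θ s Q E P ≤ G.powerObjective θ s Q E P' := by
  have key : ∀ T : Finset G.links, (∀ l ∈ T, E l.1.1 < G.Pmax) →
      ∃ P' ∈ G.power s, (∀ l ∈ T, P' l = 0) ∧
        G.powerObjective θ s Q E P ≤ G.powerObjective θ s Q E P' := by
    intro T
    induction T using Finset.induction_on with
    | empty => exact fun _ => ⟨P, hP, by simp, le_rfl⟩
    | insert l T _ ih =>
      intro hT
      obtain ⟨P', hP', h0, hle⟩ := ih fun k hk => hT k (Finset.mem_insert_of_mem hk)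
      refine ⟨Function.update P' l 0, G.power_update s P' hP' l, fun k hk => ?_,
        hle.trans (powerObjective_le_update hP' (hb l) ?_)⟩
      · rcases eq_or_ne k l with rfl | hkl
        · simp
        · rw [Function.update_of_ne hkl]
          exact h0 k (Finset.mem_of_mem_insert_of_ne hk hkl)
      · have h1 := hT l (Finset.mem_insert_self l T)
        have h2 := hθ l.1.1
        linarith
  -- All links leaving nodes with less than `Pmax` energy are switched off; the remaining nodes can
  -- afford any feasible power.
  obtain ⟨P', hP', h0, hle⟩ := key (Finset.univ.filter fun l => E l.1.1 < G.Pmax)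
    fun l hl => (Finset.mem_filter.1 hl).2
  refine ⟨P', ⟨hP', fun n => ?_⟩, hle⟩
  rcases lt_or_ge (E n) G.Pmax with hn | hn
  · refine (Finset.sum_nonpos fun l hl => (h0 l ?_).le).trans (hE n)
    rw [Finset.mem_filter, (Finset.mem_filter.1 hl).2]
    exact ⟨Finset.mem_univ _, hn⟩
  · exact (G.power_le s P' hP' n).trans hn

/-! ## Near optimality of the algorithm -/

lemma neg_dualDot_transmissionDrift (Q : N → N → ℝ) (ν : N → ℝ)
    (x : (G.links → ℝ) × (G.links → N → ℝ)) :
    -dualDot (Q, ν) (G.transmissionDrift x)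
      = ∑ l, (∑ c, x.2 l c * (Q l.1.1 c - Q l.1.2 c) - ν l.1.1 * x.1 l) := by
  simp only [dualDot, transmissionDrift, mul_sub, Finset.sum_sub_distrib]
  rw [sum_mul_outSum, Finset.sum_comm (f := fun n c => Q n c * G.inSum (fun l => x.2 l c) n),
    Finset.sum_comm (f := fun n c => Q n c * G.outSum (fun l => x.2 l c) n)]
  simp only [sum_mul_outSum G (fun n => Q n _), sum_mul_inSum G (fun n => Q n _)]
  rw [Finset.sum_comm (f := fun l c => x.2 l c * Q (Subtype.val l).1 c),
    Finset.sum_comm (f := fun l c => x.2 l c * Q (Subtype.val l).2 c)]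
  simp only [mul_comm]
  ring

/-- Queue differences exceed the link weight by at most `γ`, so using ESA's weights in place of
plain backpressure costs at most `|μmax| * γ` per link. -/
lemma neg_dualDot_transmissionDrift_le {s : S} {x : (G.links → ℝ) × (G.links → N → ℝ)}
    (hx : x ∈ G.transmissions s) (θ : N → ℝ) (Q : N → N → ℝ) (E : N → ℝ) :
    -dualDot (Q, fun n => θ n - E n) (G.transmissionDrift x)
      ≤ G.powerObjective θ s Q E x.1 + Fintype.card G.links * (|G.μmax| * G.γ) := by
  rw [neg_dualDot_transmissionDrift, powerObjective_eq]
  have hc : (Fintype.card G.links : ℝ) * (|G.μmax| * G.γ) = ∑ _l : G.links, |G.μmax| * G.γ := by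
    simp
  rw [hc, ← Finset.sum_add_distrib]
  refine Finset.sum_le_sum fun l _ => ?_
  have hW := linkWeight_nonneg Q l
  have hγ := γ_nonneg (G := G) s
  have h1 : ∑ c, x.2 l c * (Q l.1.1 c - Q l.1.2 c) ≤ (∑ c, x.2 l c) * (G.linkWeight Q l + G.γ) := by
    rw [Finset.sum_mul]
    refine Finset.sum_le_sum fun c _ => mul_le_mul_of_nonneg_left ?_ (hx.2.1 l c)
    have h2 := (le_max_left (Q l.1.1 c - Q l.1.2 c - G.γ) 0).trans (weight_le_linkWeight Q l c)
    linarith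
  have h3 := mul_le_mul_of_nonneg_right (hx.2.2 l) (add_nonneg hW hγ)
  have h4 := mul_le_mul_of_nonneg_right
    ((G.rate_le s x.1 hx.1 l).trans (le_abs_self _)) hγ
  linarith

namespace ESARun

variable {A : Matrix S S ℝ} {B : Matrix J J ℝ} {V : ℝ} {θ : N → ℝ} {Ω : Type*}
  [mΩ : MeasurableSpace Ω] {μ : Measure Ω} (X : G.ESARun A B V θ μ)

lemma admission_mem (t : ℕ) (ω : Ω) : X.R t ω ∈ G.admissions := X.R_mem t ω

lemma harvest_mem (t : ℕ) (ω : Ω) : X.e t ω ∈ G.harvests (X.energy t ω) := by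
  intro n
  rw [X.e_eq]
  split_ifs
  · exact ⟨G.harvest_nonneg _ n, le_rfl⟩
  · exact ⟨le_rfl, G.harvest_nonneg _ n⟩

lemma alloc_nonneg (t : ℕ) (ω : Ω) (l : G.links) (c : N) : 0 ≤ X.alloc t ω l c := by
  obtain ⟨k, _, hk⟩ := X.alloc_eq t ω l
  rw [hk]
  split_ifs
  · exact G.rate_nonneg _ _ (X.P_mem t ω).1 l
  · exact le_rfl

lemma sum_alloc_le (t : ℕ) (ω : Ω) (l : G.links) :
    ∑ c, X.alloc t ω l c ≤ G.rate (X.chan t ω) (X.P t ω) l := by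
  obtain ⟨k, _, hk⟩ := X.alloc_eq t ω l
  have h0 := G.rate_nonneg _ _ (X.P_mem t ω).1 l
  by_cases hW : 0 < G.linkWeight (X.Q t ω) l
  · simp [hk, hW]
  · simpa [hk, hW] using h0

lemma transmission_mem (t : ℕ) (ω : Ω) :
    (X.P t ω, X.alloc t ω) ∈ G.transmissions (X.chan t ω) :=
  ⟨(X.P_mem t ω).1, X.alloc_nonneg t ω, X.sum_alloc_le t ω⟩

lemma alloc_le (t : ℕ) (ω : Ω) (l : G.links) (c : N) : X.alloc t ω l c ≤ G.μmax :=
  (Finset.single_le_sum (fun c _ => X.alloc_nonneg t ω l c) (Finset.mem_univ c)).trans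
    ((X.sum_alloc_le t ω l).trans (G.rate_le _ _ (X.P_mem t ω).1 l))

lemma energy_nonneg (t : ℕ) (ω : Ω) (n : N) : 0 ≤ X.E t ω n :=
  (outSum_nonneg (G.power_nonneg _ _ (X.P_mem t ω).1) n).trans ((X.P_mem t ω).2 n)

lemma queue_nonneg (t : ℕ) (ω : Ω) (n c : N) : 0 ≤ X.Q t ω n c := by
  cases t with
  | zero => rw [X.Q_init]
  | succ t =>
    rcases eq_or_ne n c with rfl | h
    · rw [X.Q_dest]
    · rw [X.Q_step t ω n c h]
      have := inSum_nonneg (fun l => X.alloc_nonneg t ω l c) n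
      have := (X.R_mem t ω n c).1
      positivity

/-- Beyond `β * V` the price of admitted data exceeds the largest marginal utility. -/
lemma admission_eq_zero {t : ℕ} {ω : Ω} {n c : N} (hV : 0 ≤ V) (h : G.β * V < X.Q t ω n c) :
    X.R t ω n c = 0 := by
  have h0 := X.R_mem t ω n c
  have h1 : V * G.U n c 0 - X.Q t ω n c * 0
      ≤ V * G.U n c (X.R t ω n c) - X.Q t ω n c * X.R t ω n c :=
    X.R_max t ω n c ⟨le_rfl, G.Rmax_nonneg⟩
  rw [G.U_zero] at h1
  have h2 := mul_le_mul_of_nonneg_left (utility_le_mul (G := G) n c h0.1) hV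
  by_contra hne
  have h3 : 0 < X.R t ω n c := lt_of_le_of_ne h0.1 (Ne.symm hne)
  have h4 := mul_lt_mul_of_pos_right h h3
  linarith

/-- A queue at most `β * V` grows by at most `γ` in a slot. A queue above `β * V` admits nothing,
and receives nothing either: a positive weight into it would need an upstream queue above `β * V +
γ`. -/
lemma queue_le (hV : 0 ≤ V) (t : ℕ) (ω : Ω) (n c : N) :
    X.Q t ω n c ≤ G.β * V + G.γ := by
  have hγ := γ_nonneg (G := G) (X.chan 0 ω)
  have hβV : 0 ≤ G.β * V := mul_nonneg (β_nonneg n) hV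
  induction t generalizing n with
  | zero =>
    rw [X.Q_init]
    positivity
  | succ t ih =>
    rcases eq_or_ne n c with rfl | hnc
    · rw [X.Q_dest]
      positivity
    rw [X.Q_step t ω n c hnc]
    have ho := outSum_nonneg (fun l => X.alloc_nonneg t ω l c) n
    have hmax : max (X.Q t ω n c - G.outSum (fun l => X.alloc t ω l c) n) 0 ≤ X.Q t ω n c :=
      max_le (by linarith) (X.queue_nonneg t ω n c)
    rcases le_or_gt (X.Q t ω n c) (G.β * V) with hq | hq
    · have h1 := inSum_le_dmax_mul (X.chan t ω) (fun l => X.alloc_le t ω l c) n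
      have h2 := (X.R_mem t ω n c).2
      unfold γ
      linarith
    · have hin : G.inSum (fun l => X.alloc t ω l c) n = 0 := by
        refine Finset.sum_eq_zero fun l hl => ?_
        have hl' := (Finset.mem_filter.1 hl).2
        obtain ⟨k, hk, hk'⟩ := X.alloc_eq t ω l
        rw [hk']
        refine if_neg ?_
        rintro ⟨rfl, hpos⟩
        rw [← hk, weight, lt_max_iff, hl'] at hpos
        have h1 := ih l.1.1
        rcases hpos with h | h <;> linarith
      rw [hin, X.admission_eq_zero hV hq, add_zero, add_zero]
      exact hmax.trans (ih n)

lemma linkWeight_le (hV : 0 ≤ V) (t : ℕ) (ω : Ω) (l : G.links) :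
    G.linkWeight (X.Q t ω) l ≤ G.β * V := by
  have : Nonempty N := ⟨l.1.1⟩
  refine ciSup_le fun c => max_le ?_ (mul_nonneg (β_nonneg l.1.1) hV)
  have h1 := X.queue_le hV t ω l.1.1 c
  have h2 := X.queue_nonneg t ω l.1.2 c
  linarith

lemma powerObjective_le (hV : 0 ≤ V) (hθ : ∀ n, G.δ * G.β * V + G.Pmax ≤ θ n) (t : ℕ) (ω : Ω)
    {P : G.links → ℝ} (hP : P ∈ G.power (X.chan t ω)) :
    G.powerObjective θ (X.chan t ω) (X.Q t ω) (X.E t ω) P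
      ≤ G.powerObjective θ (X.chan t ω) (X.Q t ω) (X.E t ω) (X.P t ω) := by
  obtain ⟨P', hP', h⟩ := exists_availablePower (θ := θ) (Q := X.Q t ω) (b := G.β * V)
    (X.energy_nonneg t ω) (fun n => by rw [← mul_assoc]; exact hθ n) (X.linkWeight_le hV t ω) hP
  exact h.trans (X.P_max t ω hP')

/-- The queues of a run as a dual vector. -/
def dualPoint (t : ℕ) (ω : Ω) : (N → N → ℝ) × (N → ℝ) :=
  (X.Q t ω, fun n => θ n - X.E t ω n)

lemma dualFeasible_dualPoint (t : ℕ) (ω : Ω) : DualFeasible (X.dualPoint t ω) :=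
  ⟨X.queue_nonneg t ω, X.Q_dest t ω⟩

/-- Only links of positive weight are used, and there the queue difference is the weight plus `γ`;
so for ESA's own action the offset has the favourable sign. -/
lemma powerObjective_le_neg_dualDot (t : ℕ) (ω : Ω) :
    G.powerObjective θ (X.chan t ω) (X.Q t ω) (X.E t ω) (X.P t ω)
      ≤ -dualDot (X.dualPoint t ω) (G.transmissionDrift (X.P t ω, X.alloc t ω)) := by
  rw [dualPoint, neg_dualDot_transmissionDrift, powerObjective_eq]
  refine Finset.sum_le_sum fun l _ => ?_
  have hγ := γ_nonneg (G := G) (X.chan 0 ω)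
  have h0 := G.rate_nonneg _ _ (X.P_mem t ω).1 l
  suffices G.rate (X.chan t ω) (X.P t ω) l * G.linkWeight (X.Q t ω) l
      ≤ ∑ c, X.alloc t ω l c * (X.Q t ω l.1.1 c - X.Q t ω l.1.2 c) by
    simp only
    linarith
  obtain ⟨k, hk, hk'⟩ := X.alloc_eq t ω l
  by_cases hW : 0 < G.linkWeight (X.Q t ω) l
  · simp only [hk', hW, and_true, ite_mul, zero_mul, Finset.sum_ite_eq', Finset.mem_univ, if_true]
    refine mul_le_mul_of_nonneg_left ?_ h0
    rw [← hk] at hW ⊢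
    unfold weight at hW ⊢
    rcases lt_max_iff.1 hW with h | h
    · rw [max_eq_left h.le]
      linarith
    · exact absurd h (lt_irrefl _)
  · simp [hk', le_antisymm (not_lt.1 hW) (linkWeight_nonneg _ l)]

lemma transmissionDual_le (hV : 0 ≤ V) (hθ : ∀ n, G.δ * G.β * V + G.Pmax ≤ θ n) (t : ℕ) (ω : Ω) :
    G.transmissionDual (X.chan t ω) (X.dualPoint t ω)
      ≤ -dualDot (X.dualPoint t ω) (G.transmissionDrift (X.P t ω, X.alloc t ω))
        + Fintype.card G.links * (|G.μmax| * G.γ) := by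
  refine supAffine_le (G.transmissions_nonempty _) fun x hx => ?_
  have h1 := neg_dualDot_transmissionDrift_le hx θ (X.Q t ω) (X.E t ω)
  have h2 := X.powerObjective_le hV hθ t ω hx.1
  have h3 := X.powerObjective_le_neg_dualDot t ω
  rw [zero_sub]
  exact h1.trans (by linarith)

/-- The threshold rule is an exact maximizer: harvested energy has price `θ n - E n`, so all is
taken when this is positive and none otherwise. -/
lemma harvestDual_le (t : ℕ) (ω : Ω) :
    G.harvestDual (X.energy t ω) (X.dualPoint t ω)
      ≤ -dualDot (X.dualPoint t ω) (harvestDrift (X.e t ω)) := by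
  refine supAffine_le (G.harvests_nonempty _) fun e he => ?_
  simp only [dualDot, harvestDrift, dualPoint, Pi.zero_apply, mul_zero, Finset.sum_const_zero,
    zero_add, zero_sub, Pi.neg_apply, mul_neg, Finset.sum_neg_distrib, neg_neg]
  refine Finset.sum_le_sum fun n _ => ?_
  have h0 := he n
  rw [X.e_eq]
  split_ifs with h
  · exact mul_le_mul_of_nonneg_left h0.2 (by linarith)
  · rw [mul_zero]
    exact mul_nonpos_of_nonpos_of_nonneg (by linarith) h0.1

lemma admissionDual_le (t : ℕ) (ω : Ω) :
    G.admissionDual V (X.dualPoint t ω)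
      ≤ V * ∑ n, ∑ c, G.U n c (X.R t ω n c)
        - dualDot (X.dualPoint t ω) (admissionDrift (X.R t ω)) := by
  refine supAffine_le G.admissions_nonempty fun r hr => ?_
  simp only [dualDot, admissionDrift, dualPoint, Pi.zero_apply, mul_zero, Finset.sum_const_zero,
    add_zero, Finset.mul_sum, ← Finset.sum_sub_distrib]
  exact Finset.sum_le_sum fun n _ => Finset.sum_le_sum fun c _ => X.R_max t ω n c (hr n c)

/-- The increment of the queues in a slot, without idling. -/
def drift (t : ℕ) (ω : Ω) : (N → N → ℝ) × (N → ℝ) :=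
  admissionDrift (X.R t ω) + G.transmissionDrift (X.P t ω, X.alloc t ω) + harvestDrift (X.e t ω)

variable [Fintype J]

/-- The approximate subgradient inequality: ESA's action is nearly optimal at `dualPoint` and merely
feasible at `y`, and the utility terms cancel on subtraction. -/
lemma dualDot_drift_le (hV : 0 ≤ V) (hθ : ∀ n, G.δ * G.β * V + G.Pmax ≤ θ n) (t : ℕ) (ω : Ω)
    (y : (N → N → ℝ) × (N → ℝ)) :
    dualDot (X.dualPoint t ω - y) (X.drift t ω)
      ≤ G.slotDual V (X.chan t ω, X.energy t ω) y
        - G.slotDual V (X.chan t ω, X.energy t ω) (X.dualPoint t ω)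
        + Fintype.card G.links * (|G.μmax| * G.γ) := by
  have h1 := X.admissionDual_le t ω
  have h2 := X.transmissionDual_le hV hθ t ω
  have h3 := X.harvestDual_le t ω
  have h4 : _ ≤ G.admissionDual V y := le_supAffine (fun r hr => utility_le hV hr)
    (fun r hr => dualNorm_admissionDrift_le hr) y (X.admission_mem t ω)
  have h5 : _ ≤ G.transmissionDual (X.chan t ω) y := le_supAffine (fun _ _ => le_rfl)
    (fun x hx => dualNorm_transmissionDrift_le hx) y (X.transmission_mem t ω)
  have h6 : _ ≤ G.harvestDual (X.energy t ω) y := le_supAffine (fun _ _ => le_rfl)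
    (fun e he => dualNorm_harvestDrift_le he) y (X.harvest_mem t ω)
  simp only [slotDual, dualDot_sub_left, drift, dualDot_add_right]
  linarith

lemma queue_incr_bounds (t : ℕ) (ω : Ω) (n c : N) :
    0 ≤ G.outSum (fun l => X.alloc t ω l c) n ∧
    0 ≤ G.inSum (fun l => X.alloc t ω l c) n + X.R t ω n c ∧
    G.outSum (fun l => X.alloc t ω l c) n
      + (G.inSum (fun l => X.alloc t ω l c) n + X.R t ω n c) ≤ G.incrBound := by
  have h1 := outSum_nonneg (fun l => X.alloc_nonneg t ω l c) n
  have h2 := inSum_nonneg (fun l => X.alloc_nonneg t ω l c) n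
  have h3 := outSum_le (fun l => X.alloc_nonneg t ω l c)
    (fun l => split_le_abs (X.transmission_mem t ω) l c) n
  have h4 := inSum_le (fun l => X.alloc_nonneg t ω l c)
    (fun l => split_le_abs (X.transmission_mem t ω) l c) n
  have h5 := X.R_mem t ω n c
  have h6 := sum_harvest_nonneg (G := G)
  have h7 := abs_nonneg G.Pmax
  refine ⟨h1, add_nonneg h2 h5.1, ?_⟩
  unfold incrBound
  linarith [h5.2]

lemma abs_energy_incr_le (t : ℕ) (ω : Ω) (n : N) :
    |G.outSum (X.P t ω) n - X.e t ω n| ≤ G.incrBound := by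
  have h1 := outSum_nonneg (G.power_nonneg _ _ (X.P_mem t ω).1) n
  have h2 : G.outSum (X.P t ω) n ≤ G.Pmax := G.power_le _ _ (X.P_mem t ω).1 n
  have h3 := X.harvest_mem t ω n
  have h4 := h3.2.trans (harvest_le_sum (G := G) (X.energy t ω) n)
  have h5 := le_abs_self G.Pmax
  have h6 : 0 ≤ Fintype.card G.links * |G.μmax| := by positivity
  have h7 := G.Rmax_nonneg
  have h8 := h3.1
  have h9 := sum_harvest_nonneg (G := G)
  unfold incrBound
  exact abs_le.2 ⟨by linarith, by linarith⟩

lemma dualNorm_succ_sub_le (t : ℕ) (ω : Ω) :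
    dualNorm (X.dualPoint (t + 1) ω - X.dualPoint t ω)
      ≤ (Fintype.card N + 1) * G.incrBound := by
  refine dualNorm_le_of_abs_le incrBound_nonneg (fun n c => ?_) fun n => ?_
  · simp only [dualPoint, Prod.fst_sub, Pi.sub_apply]
    rcases eq_or_ne n c with rfl | hnc
    · simpa [X.Q_dest] using incrBound_nonneg
    · obtain ⟨h1, h2, h3⟩ := X.queue_incr_bounds t ω n c
      have h4 := X.queue_nonneg t ω n c
      rw [X.Q_step t ω n c hnc, add_assoc]
      rcases max_cases (X.Q t ω n c - G.outSum (fun l => X.alloc t ω l c) n) 0 with h | h <;>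
        rw [h.1] <;> exact abs_le.2 ⟨by linarith, by linarith⟩
  · simp only [dualPoint, Prod.snd_sub, Pi.sub_apply]
    have := X.abs_energy_incr_le t ω n
    rw [X.E_step]
    convert this using 2
    ring

/-- Expanding the square gives the drift term and a bounded second order term. Truncation of the
data queues at zero is harmless because `y.1` is nonnegative; the pairs `(c, c)` vanish in both
vectors. -/
lemma dualNorm_succ_sq_le (t : ℕ) (ω : Ω) {y : (N → N → ℝ) × (N → ℝ)} (hy : DualFeasible y) :
    dualNorm (X.dualPoint (t + 1) ω - y) ^ 2
      ≤ dualNorm (X.dualPoint t ω - y) ^ 2 + 2 * dualDot (X.dualPoint t ω - y) (X.drift t ω)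
        + (Fintype.card N * (Fintype.card N * (2 * G.incrBound ^ 2))
          + Fintype.card N * (2 * G.incrBound ^ 2)) := by
  have hQ : ∀ n c, (X.Q (t + 1) ω n c - y.1 n c) ^ 2 ≤ (X.Q t ω n c - y.1 n c) ^ 2
      + 2 * ((X.Q t ω n c - y.1 n c) * (X.R t ω n c + (G.inSum (fun l => X.alloc t ω l c) n
        - G.outSum (fun l => X.alloc t ω l c) n))) + 2 * G.incrBound ^ 2 := by
    intro n c
    rcases eq_or_ne n c with rfl | hnc
    · rw [X.Q_dest, X.Q_dest, hy.2]
      have := sq_nonneg G.incrBound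
      simpa using this
    · obtain ⟨h1, h2, h3⟩ := X.queue_incr_bounds t ω n c
      have h4 := X.queue_nonneg t ω n c
      have h5 := hy.1 n c
      rw [X.Q_step t ω n c hnc, add_assoc]
      set o := G.outSum (fun l => X.alloc t ω l c) n
      have e : X.R t ω n c + (G.inSum (fun l => X.alloc t ω l c) n - o)
          = (G.inSum (fun l => X.alloc t ω l c) n + X.R t ω n c) - o := by ring
      rw [e]
      set a := G.inSum (fun l => X.alloc t ω l c) n + X.R t ω n c
      set q := X.Q t ω n c
      set M := G.incrBound
      rcases max_cases (q - o) 0 with h | h <;> rw [h.1]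
      · have : (a - o) ^ 2 ≤ M ^ 2 := sq_le_sq' (by linarith) (by linarith)
        nlinarith [sq_nonneg M]
      -- Here the queue would become negative: `q < o`, and truncation raises it by `o - q`. The
      -- cross term `-2 * y.1 n c * (o - q)` is favourable, and the rest is of second order since
      -- `q` is itself smaller than `o`.
      · have h6 : (a - q) ^ 2 ≤ M ^ 2 := sq_le_sq' (by linarith) (by linarith)
        have h7 : o ^ 2 ≤ M ^ 2 := sq_le_sq' (by linarith) (by linarith)
        have h8 : 0 ≤ y.1 n c * (o - q) := mul_nonneg h5 (by linarith)
        nlinarith [sq_nonneg (o - 2 * q)]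
  have hE : ∀ n, (θ n - X.E (t + 1) ω n - y.2 n) ^ 2 ≤ (θ n - X.E t ω n - y.2 n) ^ 2
      + 2 * ((θ n - X.E t ω n - y.2 n) * (G.outSum (X.P t ω) n - X.e t ω n))
      + 2 * G.incrBound ^ 2 := by
    intro n
    have h1 := X.abs_energy_incr_le t ω n
    have h2 : (G.outSum (X.P t ω) n - X.e t ω n) ^ 2 ≤ G.incrBound ^ 2 :=
      sq_le_sq' (abs_le.1 h1).1 (abs_le.1 h1).2
    rw [X.E_step]
    nlinarith [sq_nonneg G.incrBound]
  have hQ' := Finset.sum_le_sum fun n (_ : n ∈ Finset.univ) =>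
    Finset.sum_le_sum fun c (_ : c ∈ Finset.univ) => hQ n c
  have hE' := Finset.sum_le_sum fun n (_ : n ∈ Finset.univ) => hE n
  simp only [Finset.sum_add_distrib, ← Finset.mul_sum, Finset.sum_const, Finset.card_univ,
    nsmul_eq_mul] at hQ' hE'
  rw [dualNorm_sq, dualNorm_sq]
  simp only [dualDot, drift, dualPoint, admissionDrift, transmissionDrift, harvestDrift,
    Prod.fst_add, Prod.snd_add, Prod.fst_sub, Prod.snd_sub, Pi.add_apply, Pi.sub_apply,
    Pi.zero_apply, Pi.neg_apply, add_zero, zero_add, ← sub_eq_add_neg]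
  linarith

end ESARun
end EnergyNetwork

lemma measurable_prodMk_pi {N Ω : Type*} {m : MeasurableSpace Ω} {f : Ω → N → N → ℝ}
    {g : Ω → N → ℝ} (hf : ∀ n c, Measurable fun ω => f ω n c) (hg : ∀ n, Measurable fun ω => g ω n) :
    Measurable fun ω => (f ω, g ω) :=
  (measurable_pi_lambda _ fun n => measurable_pi_lambda _ (hf n)).prodMk (measurable_pi_lambda _ hg)

namespace EnergyNetwork.ESARun

variable {N S J : Type*} [Fintype N] [DecidableEq N] {G : EnergyNetwork N S J}
  {A : Matrix S S ℝ} {B : Matrix J J ℝ} {V : ℝ} {θ : N → ℝ} {Ω : Type*}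
  [mΩ : MeasurableSpace Ω] {μ : Measure Ω} (X : G.ESARun A B V θ μ)

/-! ## The drift of the queues -/

lemma measurable_queue (t : ℕ) (n c : N) : Measurable[X.ℱ t] fun ω => X.Q t ω n c := by
  induction t generalizing n c with
  | zero =>
    simp only [X.Q_init]
    exact measurable_const
  | succ t ih =>
    have hle : X.ℱ t ≤ X.ℱ (t + 1) := X.ℱ.mono (Nat.le_succ t)
    refine Measurable.mono ?_ hle le_rfl
    rcases eq_or_ne n c with rfl | hnc
    · simp only [X.Q_dest]
      exact measurable_const
    · simp only [X.Q_step t _ n c hnc, outSum, inSum]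
      exact ((((ih n c).sub (Finset.measurable_fun_sum _ fun l _ => X.alloc_adapted t l c)).max
        measurable_const).add (Finset.measurable_fun_sum _ fun l _ => X.alloc_adapted t l c)).add
        (X.R_adapted t n c)

lemma measurable_energy [Finite J] (t : ℕ) (n : N) : Measurable[X.ℱ t] fun ω => X.E t ω n := by
  induction t with
  | zero =>
    simp only [X.E_init]
    exact measurable_const
  | succ t ih =>
    have hle : X.ℱ t ≤ X.ℱ (t + 1) := X.ℱ.mono (Nat.le_succ t)
    refine Measurable.mono ?_ hle le_rfl
    simp only [X.E_step, X.e_eq, outSum]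
    refine (ih.sub (Finset.measurable_fun_sum _ fun l _ => X.P_adapted t l)).add ?_
    exact Measurable.ite ((ih.sub measurable_const) measurableSet_Iio)
      (measurable_comp_of_measurableSet_eq (X.energy_adapted t) fun j => G.harvest j n)
      measurable_const

lemma measurable_dualPoint [Finite J] (t : ℕ) : Measurable[X.ℱ t] (X.dualPoint t) :=
  measurable_prodMk_pi (X.measurable_queue t)
    fun n => measurable_const.sub (X.measurable_energy t n)

-- The hypotheses on `M` match the jump of the distance, the Lipschitz bound on `F`, and the jump of
-- `F`, which is the product of the two.
open scoped Kronecker in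
lemma quadraticDrift [Fintype S] [Fintype J] {πS : S → ℝ} {πJ : J → ℝ}
    (hS : πS ∈ stdSimplex ℝ S) (hJ : πJ ∈ stdSimplex ℝ J) (hV : 0 ≤ V)
    (hθ : ∀ n, G.δ * G.β * V + G.Pmax ≤ θ n) {y : (N → N → ℝ) × (N → ℝ)} (hy : DualFeasible y)
    {L M : ℝ}
    (hL : ∀ z, DualFeasible z → G.dual πS πJ V y + L * dualNorm (y - z) ≤ G.dual πS πJ V z)
    (hM₁ : (Fintype.card N + 1) * G.incrBound ≤ M)
    (hM₂ : 3 * ((Fintype.card N + 1) * G.incrBound) ≤ M)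
    (hM₃ : 3 * ((Fintype.card N + 1) * G.incrBound) * ((Fintype.card N + 1) * G.incrBound) ≤ M) :
    QuadraticDrift (A ⊗ₖ B) (fun i : S × J => πS i.1 * πJ i.2) M
      ((Fintype.card N * (Fintype.card N * (2 * G.incrBound ^ 2))
          + Fintype.card N * (2 * G.incrBound ^ 2))
        + 2 * (Fintype.card G.links * (|G.μmax| * G.γ))) L μ X.ℱ
      (fun t ω => (X.chan t ω, X.energy t ω)) (fun t ω => dualNorm (X.dualPoint t ω - y))
      (fun t i ω => G.slotDual V i y - G.slotDual V i (X.dualPoint t ω)) where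
  meas_X t i := by
    have : {ω | (X.chan t ω, X.energy t ω) = i}
        = {ω | X.chan t ω = i.1} ∩ {ω | X.energy t ω = i.2} := by
      ext ω
      simp [Prod.ext_iff]
    rw [this]
    exact (X.chan_adapted t i.1).inter (X.energy_adapted t i.2)
  markov t i := by
    obtain ⟨s, j⟩ := i
    simp only [Prod.mk.injEq]
    exact X.markov t s j
  meas_w t := by
    have hc : Continuous fun z : (N → N → ℝ) × (N → ℝ) => dualNorm (z - y) := by
      unfold dualNorm
      fun_prop
    exact hc.measurable.comp (X.measurable_dualPoint t)
  meas_F t i := measurable_const.sub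
    ((continuous_of_abs_sub_le_dualNorm (abs_slotDual_sub_le hV i)).measurable.comp
      (X.measurable_dualPoint t))
  nonneg t ω := dualNorm_nonneg _
  init := by
    refine ⟨dualNorm ((0, θ) - y), fun ω => le_of_eq ?_⟩
    congr 2
    ext <;> simp [dualPoint, X.Q_init, X.E_init]
  jump t ω := (abs_dualNorm_sub_le _ _ _).trans ((X.dualNorm_succ_sub_le t ω).trans hM₁)
  abs_F t i ω := by
    rw [dualNorm_sub_comm]
    exact (abs_slotDual_sub_le hV i _ _).trans
      (mul_le_mul_of_nonneg_right hM₂ (dualNorm_nonneg _))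
  jump_F t i ω := by
    rw [sub_sub_sub_cancel_left, abs_sub_comm]
    refine (abs_slotDual_sub_le hV i _ _).trans (le_trans ?_ hM₃)
    exact mul_le_mul_of_nonneg_left (X.dualNorm_succ_sub_le t ω)
      (by have := incrBound_nonneg (G := G); positivity)
  sq_le t ω := by
    have h1 := X.dualNorm_succ_sq_le t ω hy
    have h2 := X.dualDot_drift_le hV hθ t ω y
    linarith
  mean t ω := by
    have h1 := hL _ (X.dualFeasible_dualPoint t ω)
    rw [dual_eq_sum_slotDual hS hJ hV, dual_eq_sum_slotDual hS hJ hV, dualNorm_sub_comm] at h1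
    simp only [mul_sub, Finset.sum_sub_distrib]
    linarith

lemma le_dualNorm_of_mem_deviation {y : (N → N → ℝ) × (N → ℝ)} {a : ℝ} {t : ℕ} {ω : Ω}
    (h : ω ∈ X.deviation y a t) : a ≤ dualNorm (X.dualPoint t ω - y) := by
  rcases h with ⟨n, c, h⟩ | ⟨n, h⟩
  · exact h.le.trans (abs_fst_le_dualNorm (X.dualPoint t ω - y) n c)
  · refine h.le.trans ?_
    have e : X.E t ω n - θ n + y.2 n = -(X.dualPoint t ω - y).2 n := by
      simp only [dualPoint, Prod.snd_sub, Pi.sub_apply]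
      ring
    rw [e, abs_neg]
    exact abs_snd_le_dualNorm (X.dualPoint t ω - y) n

end EnergyNetwork.ESARun

/-! ### Homogeneity of the dual optimum and conclusion. -/

namespace EnergyNetwork

variable {N S J : Type*} [Fintype N] [DecidableEq N] [Fintype S] [Fintype J]
  {G : EnergyNetwork N S J}

/-- The optima of the dual problem are homogeneous in the parameter `V`. -/
lemma IsDualOptimum.smul {πS : S → ℝ} {πJ : J → ℝ} {y : (N → N → ℝ) × (N → ℝ)}
    (h : G.IsDualOptimum πS πJ 1 y) {V : ℝ} (hV : 0 < V) : G.IsDualOptimum πS πJ V (V • y) := by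
  refine ⟨⟨fun n c => mul_nonneg hV.le (h.1.1 n c), fun c => ?_⟩, fun z hz => ?_⟩
  · simp [h.1.2 c]
  · have hz' : DualFeasible (V⁻¹ • z) :=
      ⟨fun n c => mul_nonneg (inv_nonneg.2 hV.le) (hz.1 n c), fun c => by simp [hz.2 c]⟩
    have h1 := mul_le_mul_of_nonneg_left (h.2 _ hz') hV.le
    rwa [← dual_smul hV.le, ← dual_smul hV.le, smul_inv_smul₀ hV.ne'] at h1

end EnergyNetwork

end

theorem theorem4 {N S J : Type*} [Fintype N] [DecidableEq N] [Fintype S] [DecidableEq S]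
    [Fintype J] [DecidableEq J] (G : EnergyNetwork N S J)
    (A : Matrix S S ℝ) (hA : IsErgodicChain A) (B : Matrix J J ℝ) (hB : IsErgodicChain B)
    (πS : S → ℝ) (hπS : IsStationaryDist A πS) (πJ : J → ℝ) (hπJ : IsStationaryDist B πJ)
    (yStar : ℝ → (N → N → ℝ) × (N → ℝ))
    (hopt : ∀ V, 1 ≤ V → G.IsDualOptimum πS πJ V (yStar V))
    (huniq : ∀ V, 1 ≤ V → ∀ y, G.IsDualOptimum πS πJ V y → y = yStar V)
    (L : ℝ) (hL : 0 < L)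
    (hpoly : ∀ V, 1 ≤ V → ∀ y, DualFeasible y →
      G.dual πS πJ V (yStar V) + L * dualNorm (yStar V - y) ≤ G.dual πS πJ V y) :
    (∃ y₁ : (N → N → ℝ) × (N → ℝ), (∀ V, 1 ≤ V → yStar V = V • y₁) ∧
      (y₁ ≠ 0 → (fun V => dualNorm (yStar V)) =Θ[atTop] fun V : ℝ => V)) ∧
    ∃ D K cStar : ℝ, 0 < D ∧ 0 < K ∧ 0 < cStar ∧
      ∀ (V : ℝ), 1 ≤ V → ∀ θ : N → ℝ,
        (∀ n, G.δ * G.β * V + G.Pmax ≤ θ n) → (∀ n, 0 < θ n - (yStar V).2 n) →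
        ∀ {Ω : Type*} [MeasurableSpace Ω] (μ : Measure Ω) [IsProbabilityMeasure μ]
          (X : G.ESARun A B V θ μ) (m : ℝ), 0 ≤ m →
          limsup (fun t : ℕ =>
            (1 / (t : ℝ)) * ∑ τ ∈ Finset.range t, μ.real (X.deviation (yStar V) (D + K * m) τ)) atTop
            ≤ cStar * Real.exp (-m) := by
  constructor
  · have hlin : ∀ V, 1 ≤ V → yStar V = V • yStar 1 := fun V hV =>
      (huniq V hV _ ((hopt 1 le_rfl).smul (by linarith))).symm
    refine ⟨yStar 1, hlin, fun hne => ?_⟩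
    have hpos := dualNorm_pos hne
    have heq : (fun V => dualNorm (yStar V)) =ᶠ[atTop] fun V => dualNorm (yStar 1) * V := by
      filter_upwards [eventually_ge_atTop 1] with V hV
      rw [hlin V hV, dualNorm_smul (by linarith), mul_comm]
    exact heq.trans_isTheta ((isTheta_refl _ _).const_mul_left hpos.ne')
  · set b := (Fintype.card N + 1) * G.incrBound with hb
    have hb0 : 0 ≤ b := mul_nonneg (by positivity) EnergyNetwork.incrBound_nonneg
    have hS : Nonempty S := by
      by_contra h
      rw [not_nonempty_iff] at h
      simpa using hπS.1.2
    have hγ : 0 ≤ G.γ := EnergyNetwork.γ_nonneg hS.some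
    obtain ⟨n₁, hn₁⟩ := hA.exists_pow_pos
    obtain ⟨n₂, hn₂⟩ := hB.exists_pow_pos
    -- Both factors have positive powers at all large exponents, hence at a common one, which makes
    -- the product chain eventually positive.
    have hpow : ∀ i j, 0 < (Matrix.kroneckerMap (· * ·) A B ^ (n₁ + n₂)) i j := by
      intro i j
      rw [Matrix.kronecker_pow]
      exact mul_pos (hn₁ _ (Nat.le_add_right _ _) _ _) (hn₂ _ (Nat.le_add_left _ _) _ _)
    obtain ⟨D, K, c, hD, hK, hc, h⟩ := exists_exponential_attraction
      (fun ε hε => Matrix.exists_sum_abs_pow_sub_le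
        (Matrix.kronecker_mem_rowStochastic hA.stochastic hB.stochastic) hpow
        (hπS.kronecker hπJ) hε)
      -- The sum dominates the three bounds required by `quadraticDrift`, and the `1` makes it
      -- positive.
      (M := b + 3 * b + 3 * b * b + 1)
      (C := (Fintype.card N * (Fintype.card N * (2 * G.incrBound ^ 2))
          + Fintype.card N * (2 * G.incrBound ^ 2))
        + 2 * (Fintype.card G.links * (|G.μmax| * G.γ)))
      (by positivity) (by positivity) hL
    refine ⟨D, K, c, hD, hK, hc, fun V hV θ hθ _ Ω _ μ _ X m _ => ?_⟩
    have hbb : 0 ≤ 3 * b * b := by positivity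
    exact h μ X.ℱ _ _ _ (X.quadraticDrift hπS.1 hπJ.1 (by linarith) hθ (hopt V hV).1
      (hpoly V hV) (by linarith) (by linarith) (by linarith)) m _
      fun t ω hω => X.le_dualNorm_of_mem_deviation hω
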